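/- Let $\kappa$ be a regular cardinal and $\lambda<\kappa$ a smaller infinite cardinal. Let $\mathbf{CAT}$ be the $2$-category of locally small categories, and let $\mathbf{ACC}^\kappa_{\lambda,\kappa}\subset\mathbf{CAT}$ be the following $2$-subcategory. Its objects are the $\kappa$-accessible categories in which all $\lambda$-indexed chains (functors from the ordered set $\lambda$) have colimits. Its $1$-cells are the functors that preserve $\kappa$-directed colimits and colimits of $\lambda$-indexed chains and take $\kappa$-presentable objects to $\kappa$-presentable objects. Its $2$-cells are arbitrary natural transformations. Let $\Gamma$ be a $\kappa$-small (strict) $2$-category, i.e. one with fewer than $\kappa$ objects, fewer than $\kappa$ $1$-cells and fewer than $\kappa$ $2$-cells, and let $H\colon\Gamma\to\mathbf{ACC}^\kappa_{\lambda,\kappa}$ be a (strict) $2$-functor. The (conical) pseudolimit $\mathsf E$ of $H$ is the following category. An object $E$ of $\mathsf E$ consists of an object $E_\gamma\in H(\gamma)$ for every object $\gamma\in\Gamma$ and an isomorphism $e_a\colon H(a)(E_\gamma)\to E_\delta$ in $H(\delta)$ for every $1$-cell $a\colon\gamma\to\delta$ in $\Gamma$, such that $e_{\mathrm{id}_\gamma}=\mathrm{id}_{E_\gamma}$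 for every object $\gamma$, $e_{ba}=e_b\circ H(b)(e_a)$ for all composable $1$-cells $a\colon\gamma\to\delta$ and $b\colon\delta\to\epsilon$, and $e_b\circ H(t)_{E_\gamma}=e_a$ for every $2$-cell $t\colon a\to b$ between $1$-cells $a,b\colon\gamma\rightrightarrows\delta$. A morphism $f\colon E\to E'$ in $\mathsf E$ is a family of morphisms $f_\gamma\colon E_\gamma\to E'_\gamma$ in $H(\gamma)$ such that $f_\delta\circ e_a=e'_a\circ H(a)(f_\gamma)$ for every $1$-cell $a\colon\gamma\to\delta$. Then: 1. the category $\mathsf E$ belongs to $\mathbf{ACC}^\kappa_{\lambda,\kappa}$, i.e. it is $\kappa$-accessible and has colimits of all $\lambda$-indexed chains; 2. for every object $\gamma\in\Gamma$, the projection functor $\mathsf E\to H(\gamma)$, $E\mapsto E_\gamma$, belongs to $\mathbf{ACC}^\kappa_{\lambda,\kappa}$; 3. an object $S\in\mathsf E$ is $\kappa$-presentable if and only if, for every object $\gamma\in\Gamma$, the object $S_\gamma$ is $\kappa$-presentable in $H(\gamma)$. -/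

import Mathlib

open CategoryTheory Limits Bicategory

universe w u

/-- A 2-category is `κ`-small if it has fewer than `κ` objects, fewer than `κ` 1-cells and
fewer than `κ` 2-cells. -/
structure IsCardinalSmallTwoCategory (Γ : Type w) [Bicategory.{w, w} Γ]
    (κ : Cardinal.{w}) : Prop where
  objects : HasCardinalLT Γ κ
  oneCells : HasCardinalLT (Σ (γ δ : Γ), (γ ⟶ δ)) κ
  twoCells : HasCardinalLT (Σ (γ δ : Γ) (a b : γ ⟶ δ), (a ⟶ b)) κ

/-- The objects of the 2-category `ACC_{lam,κ}` (equivalently, of `ACC^κ_{lam,κ}`):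
`κ`-accessible categories in which all chains indexed by the cardinal `lam` have colimits.
As usual, the cardinal `lam` is identified with the well-ordered set of all
ordinals smaller than it, viewed as a category. -/
structure IsACCObject (C : Type*) [Category* C]
    (lam κ : Cardinal.{w}) [Fact κ.IsRegular] : Prop where
  accessible : IsCardinalAccessibleCategory C κ
  hasColimitsOfChains : HasColimitsOfShape lam.ord.ToType C

/-- The 1-cells of the 2-category `ACC^κ_{lam,κ}`: functors preserving `κ`-directed
(equivalently, `κ`-filtered) colimits and colimits of `lam`-indexed chains, and taking
`κ`-presentable objects to `κ`-presentable objects.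
(The 2-cells are arbitrary natural transformations.) -/
structure IsACCFunctor {C D : Type*} [Category* C] [Category* D] (F : C ⥤ D)
    (lam κ : Cardinal.{w}) [Fact κ.IsRegular] : Prop where
  preservesFiltered : F.IsCardinalAccessible κ
  preservesChains : PreservesColimitsOfShape lam.ord.ToType F
  presentable : ∀ X : C, IsCardinalPresentable X κ → IsCardinalPresentable (F.obj X) κ

section

variable {Γ : Type w} [Bicategory.{w, w} Γ] [Bicategory.Strict Γ]

/-- A 2-functor `H` from `Γ` to the 2-category of categories takes values in the (locally full)
2-subcategory `ACC^κ_{lam,κ}`. -/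
structure TakesValuesInACC (H : StrictPseudofunctor Γ Cat.{w, u})
    (lam κ : Cardinal.{w}) [Fact κ.IsRegular] : Prop where
  obj : ∀ γ : Γ, IsACCObject (H.obj γ) lam κ
  map : ∀ {γ δ : Γ} (a : γ ⟶ δ), IsACCFunctor (H.map a).toFunctor lam κ

/-- Objects of the conical lax limit of a 2-functor `H` from `Γ` to the 2-category of categories.
As `H` is a 2-functor, `H (𝟙 γ)` is equal to the identity functor and `H (a ≫ b)` to the
composite of `H a` and `H b`. The components of `H.mapId` and `H.mapComp` in the conditions are
the identity morphisms (`eqToHom`) expressing these equalities. -/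
structure ConicalLaxLimit (H : StrictPseudofunctor Γ Cat.{w, u}) where
  /-- the component `L_γ` -/
  obj (γ : Γ) : H.obj γ
  /-- the morphism `l_a : H(a)(L_γ) ⟶ L_δ` -/
  str {γ δ : Γ} (a : γ ⟶ δ) : (H.map a).toFunctor.obj (obj γ) ⟶ obj δ
  str_id (γ : Γ) : str (𝟙 γ) = (H.mapId γ).hom.toNatTrans.app (obj γ)
  str_comp {γ δ θ : Γ} (a : γ ⟶ δ) (b : δ ⟶ θ) :
    str (a ≫ b) = (H.mapComp a b).hom.toNatTrans.app (obj γ) ≫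
      (H.map b).toFunctor.map (str a) ≫ str b
  str_two {γ δ : Γ} {a b : γ ⟶ δ} (t : a ⟶ b) :
    (H.map₂ t).toNatTrans.app (obj γ) ≫ str b = str a

namespace ConicalLaxLimit

variable {H : StrictPseudofunctor Γ Cat.{w, u}}

/-- Morphisms in the conical lax limit: families of morphisms `L_γ ⟶ M_γ` compatible with the
structure morphisms. -/
@[ext]
structure Hom (L M : ConicalLaxLimit H) where
  app (γ : Γ) : L.obj γ ⟶ M.obj γ
  comm {γ δ : Γ} (a : γ ⟶ δ) :
    L.str a ≫ app δ = (H.map a).toFunctor.map (app γ) ≫ M.str a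

instance : Category (ConicalLaxLimit H) where
  Hom := Hom
  id L := { app := fun γ => 𝟙 (L.obj γ), comm := by intros; simp }
  comp f g :=
    { app := fun γ => f.app γ ≫ g.app γ
      comm := by
        intro γ δ a
        rw [← Category.assoc, f.comm, Category.assoc, g.comm, Functor.map_comp, Category.assoc] }
  id_comp f := by apply Hom.ext; funext γ; exact Category.id_comp _
  comp_id f := by apply Hom.ext; funext γ; exact Category.comp_id _
  assoc f g h := by apply Hom.ext; funext γ; exact Category.assoc _ _ _

/-- The projection functor from the conical lax limit to the category `H γ`. -/
def proj (H : StrictPseudofunctor Γ Cat.{w, u}) (γ : Γ) : ConicalLaxLimit H ⥤ H.obj γ where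
  obj L := L.obj γ
  map f := Hom.app f γ
  map_id _ := rfl
  map_comp _ _ := rfl

/-- The property of an object of the conical lax limit that all its structure morphisms
are isomorphisms. -/
def isPseudo (H : StrictPseudofunctor Γ Cat.{w, u}) : ObjectProperty (ConicalLaxLimit H) :=
  fun L => ∀ ⦃γ δ : Γ⦄ (a : γ ⟶ δ), IsIso (L.str a)

end ConicalLaxLimit

/-- The conical pseudolimit of a 2-functor: the full subcategory of the conical lax limit
consisting of all the objects whose structure morphisms are isomorphisms. -/
abbrev ConicalPseudolimit (H : StrictPseudofunctor Γ Cat.{w, u}) : Type (max w u) :=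
  (ConicalLaxLimit.isPseudo H).FullSubcategory

/-- The projection functor from the conical pseudolimit to the category `H γ`. -/
def ConicalPseudolimit.proj (H : StrictPseudofunctor Γ Cat.{w, u}) (γ : Γ) :
    ConicalPseudolimit H ⥤ H.obj γ :=
  (ConicalLaxLimit.isPseudo H).ι ⋙ ConicalLaxLimit.proj H γ

end

-- Colimits of a shape that all `H γ` have and all `H a` preserve are computed componentwise in the
-- pseudolimit. This gives `κ`-filtered colimits, colimits of `lam`-chains, and their preservation
-- by the projections. Objects with `κ`-presentable components are `κ`-presentable because a
-- morphism is subject to fewer than `κ` conditions (`isCardinalPresentable_of_proj`). The real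
-- content is that such objects generate.
--
-- Present all components of `E` as colimits of `κ`-presentables over one `κ`-directed poset `J`.
-- The structure isomorphisms and their inverses do not restrict to the terms of the presentations.
-- They do so only after moving from an index `src` to a larger index `tgt`, and the equations
-- between them hold only after moving further: these are `Stage` and `Stage.Prec`. Any fewer than
-- `κ` stages have a common successor (`exists_forall_prec`), so there are chains of stages of
-- length `lam`. In the colimit of such a chain every delay is absorbed, and the approximations
-- become honest, mutually inverse, coherent structure morphisms. As `lam < κ`, the colimit still
-- has `κ`-presentable components. This produces many componentwise presentable objects over `E`
-- (`exists_hom_of_stage`, `exists_extension`).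
--
-- Consequently the componentwise presentable objects over `E` form an essentially small
-- `κ`-filtered category whose canonical cocone is colimit in every component, hence in the
-- pseudolimit. Every `κ`-presentable object is then a retract of a componentwise presentable one,
-- and projections preserve retracts.

universe v v₁ u₁

set_option linter.unusedSectionVars false

section

attribute [local instance 2000] CategoryStruct.toQuiver

/-! ### Componentwise description of the pseudolimit -/

section

variable {Γ : Type w} [Bicategory.{w, w} Γ]

namespace CategoryTheory.StrictPseudofunctor

variable (H : StrictPseudofunctor Γ Cat.{w, u})

/-- The component at `X` of the identification of `H (𝟙 γ)` with the identity functor. -/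
def idApp (γ : Γ) (X : H.obj γ) : (H.map (𝟙 γ)).toFunctor.obj X ⟶ X :=
  (H.mapId γ).hom.toNatTrans.app X

/-- The component at `X` of the identification of `H (a ≫ b)` with the composite of `H a`
and `H b`. -/
def compApp {γ δ θ : Γ} (a : γ ⟶ δ) (b : δ ⟶ θ) (X : H.obj γ) :
    (H.map (a ≫ b)).toFunctor.obj X ⟶
      (H.map b).toFunctor.obj ((H.map a).toFunctor.obj X) :=
  (H.mapComp a b).hom.toNatTrans.app X

/-- The component at `X` of the natural transformation `H t`. -/
def twoApp {γ δ : Γ} {a b : γ ⟶ δ} (t : a ⟶ b) (X : H.obj γ) :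
    (H.map a).toFunctor.obj X ⟶ (H.map b).toFunctor.obj X :=
  (H.map₂ t).toNatTrans.app X

lemma idApp_naturality {γ : Γ} {X Y : H.obj γ} (f : X ⟶ Y) :
    (H.map (𝟙 γ)).toFunctor.map f ≫ H.idApp γ Y = H.idApp γ X ≫ f :=
  (H.mapId γ).hom.toNatTrans.naturality f

lemma compApp_naturality {γ δ θ : Γ} (a : γ ⟶ δ) (b : δ ⟶ θ) {X Y : H.obj γ} (f : X ⟶ Y) :
    (H.map (a ≫ b)).toFunctor.map f ≫ H.compApp a b Y =
      H.compApp a b X ≫ (H.map b).toFunctor.map ((H.map a).toFunctor.map f) :=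
  (H.mapComp a b).hom.toNatTrans.naturality f

lemma twoApp_naturality {γ δ : Γ} {a b : γ ⟶ δ} (t : a ⟶ b) {X Y : H.obj γ} (f : X ⟶ Y) :
    (H.map a).toFunctor.map f ≫ H.twoApp t Y =
      H.twoApp t X ≫ (H.map b).toFunctor.map f :=
  (H.map₂ t).toNatTrans.naturality f

end CategoryTheory.StrictPseudofunctor

variable [Bicategory.Strict Γ]

namespace ConicalPseudolimit

variable {H : StrictPseudofunctor Γ Cat.{w, u}}

/-- The structure isomorphism of an object of the conical pseudolimit. -/
def str (E : ConicalPseudolimit H) {γ δ : Γ} (a : γ ⟶ δ) :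
    (H.map a).toFunctor.obj ((proj H γ).obj E) ⟶ (proj H δ).obj E :=
  E.obj.str a

instance (E : ConicalPseudolimit H) {γ δ : Γ} (a : γ ⟶ δ) : IsIso (E.str a) :=
  E.property a

lemma str_id (E : ConicalPseudolimit H) (γ : Γ) : E.str (𝟙 γ) = H.idApp γ _ :=
  E.obj.str_id γ

lemma str_comp (E : ConicalPseudolimit H) {γ δ θ : Γ} (a : γ ⟶ δ) (b : δ ⟶ θ) :
    E.str (a ≫ b) = H.compApp a b _ ≫ (H.map b).toFunctor.map (E.str a) ≫ E.str b :=
  E.obj.str_comp a b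

lemma str_two (E : ConicalPseudolimit H) {γ δ : Γ} {a b : γ ⟶ δ} (t : a ⟶ b) :
    H.twoApp t _ ≫ E.str b = E.str a :=
  E.obj.str_two t

lemma str_naturality {E E' : ConicalPseudolimit H} (f : E ⟶ E') {γ δ : Γ} (a : γ ⟶ δ) :
    E.str a ≫ (proj H δ).map f = (H.map a).toFunctor.map ((proj H γ).map f) ≫ E'.str a :=
  f.hom.comm a

/-- A morphism in the conical pseudolimit from its components. -/
def homMk {E E' : ConicalPseudolimit H} (f : ∀ γ, (proj H γ).obj E ⟶ (proj H γ).obj E')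
    (hf : ∀ ⦃γ δ : Γ⦄ (a : γ ⟶ δ),
      E.str a ≫ f δ = (H.map a).toFunctor.map (f γ) ≫ E'.str a) : E ⟶ E' :=
  ObjectProperty.homMk ⟨f, fun a ↦ hf a⟩

@[simp]
lemma proj_map_homMk {E E' : ConicalPseudolimit H}
    (f : ∀ γ, (proj H γ).obj E ⟶ (proj H γ).obj E')
    (hf : ∀ ⦃γ δ : Γ⦄ (a : γ ⟶ δ),
      E.str a ≫ f δ = (H.map a).toFunctor.map (f γ) ≫ E'.str a) (γ : Γ) :
    (proj H γ).map (homMk f hf) = f γ := rfl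

lemma hom_ext {E E' : ConicalPseudolimit H} {f g : E ⟶ E'}
    (h : ∀ γ, (proj H γ).map f = (proj H γ).map g) : f = g :=
  ObjectProperty.hom_ext _ (ConicalLaxLimit.Hom.ext (funext h))

/-- Two objects of the conical pseudolimit are isomorphic if their components are, compatibly
with the structure isomorphisms. -/
def isoMk {E E' : ConicalPseudolimit H} (e : ∀ γ, (proj H γ).obj E ≅ (proj H γ).obj E')
    (he : ∀ ⦃γ δ : Γ⦄ (a : γ ⟶ δ),
      E.str a ≫ (e δ).hom = (H.map a).toFunctor.map (e γ).hom ≫ E'.str a) : E ≅ E' where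
  hom := homMk (fun γ ↦ (e γ).hom) he
  inv := homMk (fun γ ↦ (e γ).inv) (fun γ δ a ↦ by
    rw [← cancel_mono (e δ).hom, Category.assoc, Category.assoc, he,
      ← Functor.map_comp_assoc]
    simp)
  hom_inv_id := hom_ext fun γ ↦ by simp
  inv_hom_id := hom_ext fun γ ↦ by simp

/-! ### Gluing colimits in the components into an object of the pseudolimit -/

section Gluing

variable {K : Type u₁} [Category.{v₁} K] {F : ∀ γ, K ⥤ H.obj γ} {c : ∀ γ, Cocone (F γ)}
  (hc : ∀ γ, IsColimit (c γ))

/-- Data that equip a family of colimits `c γ` of diagrams in the categories `H γ` with the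
structure of an object of the conical pseudolimit. -/
structure GluingData (c : ∀ γ, Cocone (F γ)) where
  /-- the structure morphism on the terms of the diagrams -/
  fwd {γ δ : Γ} (a : γ ⟶ δ) (i : K) : (H.map a).toFunctor.obj ((F γ).obj i) ⟶ (c δ).pt
  /-- the inverse of the structure morphism on the terms of the diagrams -/
  bwd {γ δ : Γ} (a : γ ⟶ δ) (i : K) : (F δ).obj i ⟶ (H.map a).toFunctor.obj (c γ).pt
  fwd_naturality {γ δ : Γ} (a : γ ⟶ δ) {i j : K} (k : i ⟶ j) :
    (H.map a).toFunctor.map ((F γ).map k) ≫ fwd a j = fwd a i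
  bwd_naturality {γ δ : Γ} (a : γ ⟶ δ) {i j : K} (k : i ⟶ j) :
    (F δ).map k ≫ bwd a j = bwd a i
  fwd_id (γ : Γ) (i : K) : fwd (𝟙 γ) i = H.idApp γ _ ≫ (c γ).ι.app i
  -- Here and in `fwd_bwd`, `bwd_fwd`, an arbitrary extension `s` or `r` to the colimit stands for
  -- the induced morphism, so that the data can be stated before knowing that the cocones are
  -- colimits or are preserved.
  fwd_comp {γ δ θ : Γ} (a : γ ⟶ δ) (b : δ ⟶ θ)
    (s : (H.map b).toFunctor.obj (c δ).pt ⟶ (c θ).pt)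
    (hs : ∀ i, (H.map b).toFunctor.map ((c δ).ι.app i) ≫ s = fwd b i) (i : K) :
    fwd (a ≫ b) i = H.compApp a b _ ≫ (H.map b).toFunctor.map (fwd a i) ≫ s
  fwd_two {γ δ : Γ} {a b : γ ⟶ δ} (t : a ⟶ b) (i : K) : H.twoApp t _ ≫ fwd b i = fwd a i
  fwd_bwd {γ δ : Γ} (a : γ ⟶ δ) (r : (c δ).pt ⟶ (H.map a).toFunctor.obj (c γ).pt)
    (hr : ∀ i, (c δ).ι.app i ≫ r = bwd a i) (i : K) :
    fwd a i ≫ r = (H.map a).toFunctor.map ((c γ).ι.app i)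
  bwd_fwd {γ δ : Γ} (a : γ ⟶ δ) (s : (H.map a).toFunctor.obj (c γ).pt ⟶ (c δ).pt)
    (hs : ∀ i, (H.map a).toFunctor.map ((c γ).ι.app i) ≫ s = fwd a i) (i : K) :
    bwd a i ≫ s = (c δ).ι.app i

namespace GluingData

variable (d : GluingData c)
  [∀ (γ δ : Γ) (a : γ ⟶ δ), PreservesColimitsOfShape K (H.map a).toFunctor]

include hc in
lemma hom_ext_map {γ δ : Γ} (a : γ ⟶ δ) {Z : H.obj δ}
    {s t : (H.map a).toFunctor.obj (c γ).pt ⟶ Z}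
    (h : ∀ i, (H.map a).toFunctor.map ((c γ).ι.app i) ≫ s =
      (H.map a).toFunctor.map ((c γ).ι.app i) ≫ t) : s = t :=
  (isColimitOfPreserves (H.map a).toFunctor (hc γ)).hom_ext h

/-- The structure morphism of the glued object. -/
noncomputable def str {γ δ : Γ} (a : γ ⟶ δ) : (H.map a).toFunctor.obj (c γ).pt ⟶ (c δ).pt :=
  (isColimitOfPreserves (H.map a).toFunctor (hc γ)).desc
    { pt := (c δ).pt
      ι :=
        { app := fun i ↦ d.fwd a i
          naturality := fun _ _ k ↦ (d.fwd_naturality a k).trans (Category.comp_id _).symm } }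

lemma map_ι_str {γ δ : Γ} (a : γ ⟶ δ) (i : K) :
    (H.map a).toFunctor.map ((c γ).ι.app i) ≫ d.str hc a = d.fwd a i :=
  (isColimitOfPreserves (H.map a).toFunctor (hc γ)).fac _ i

lemma isIso_str {γ δ : Γ} (a : γ ⟶ δ) : IsIso (d.str hc a) := by
  let r : (c δ).pt ⟶ (H.map a).toFunctor.obj (c γ).pt := (hc δ).desc
    { pt := (H.map a).toFunctor.obj (c γ).pt
      ι :=
        { app := fun i ↦ d.bwd a i
          naturality := fun _ _ k ↦ (d.bwd_naturality a k).trans (Category.comp_id _).symm } }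
  have hr (i : K) : (c δ).ι.app i ≫ r = d.bwd a i := (hc δ).fac _ i
  refine ⟨r, hom_ext_map hc a fun i ↦ ?_, (hc δ).hom_ext fun i ↦ ?_⟩
  · rw [reassoc_of% d.map_ι_str hc, d.fwd_bwd a r hr i]
    exact (Category.comp_id _).symm
  · rw [← Category.assoc, hr, Category.comp_id]
    exact d.bwd_fwd a _ (d.map_ι_str hc a) i

/-- The object of the conical pseudolimit with components the given colimits. -/
noncomputable def glue : ConicalPseudolimit H where
  obj :=
    { obj := fun γ ↦ (c γ).pt
      str := fun a ↦ d.str hc a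
      str_id := fun γ ↦ hom_ext_map hc _ fun i ↦ by
        rw [map_ι_str, d.fwd_id]
        exact (H.idApp_naturality _).symm
      str_comp := fun a b ↦ hom_ext_map hc _ fun i ↦ by
        rw [map_ι_str, d.fwd_comp a b (d.str hc b) (d.map_ι_str hc b), ← d.map_ι_str hc a,
          Functor.map_comp, Category.assoc]
        exact ((reassoc_of% H.compApp_naturality a b ((c _).ι.app i)) _).symm
      str_two := fun {γ δ a b} t ↦ hom_ext_map hc _ fun i ↦ by
        rw [map_ι_str, ← d.fwd_two t, ← d.map_ι_str hc b]
        exact (reassoc_of% H.twoApp_naturality t ((c γ).ι.app i)) _ }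
  property := fun _ _ a ↦ d.isIso_str hc a

lemma map_ι_glue_str {γ δ : Γ} (a : γ ⟶ δ) (i : K) :
    (H.map a).toFunctor.map ((c γ).ι.app i) ≫ (d.glue hc).str a = d.fwd a i :=
  d.map_ι_str hc a i

/-- Morphisms out of the glued object. -/
noncomputable def glueDesc {E : ConicalPseudolimit H} (r : ∀ γ, (c γ).pt ⟶ (proj H γ).obj E)
    (hr : ∀ ⦃γ δ : Γ⦄ (a : γ ⟶ δ) (i : K), d.fwd a i ≫ r δ =
      (H.map a).toFunctor.map ((c γ).ι.app i ≫ r γ) ≫ E.str a) : d.glue hc ⟶ E :=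
  homMk r (fun γ δ a ↦ hom_ext_map hc _ fun i ↦ by
    refine ((reassoc_of% d.map_ι_str hc a i) _).trans ((hr a i).trans ?_)
    rw [Functor.map_comp, Category.assoc]
    rfl)

end GluingData

end Gluing

/-! ### Componentwise colimits -/

section Colimits

variable {K : Type u₁} [Category.{v₁} K]
  [∀ (γ δ : Γ) (a : γ ⟶ δ), PreservesColimitsOfShape K (H.map a).toFunctor]

/-- A cocone in the conical pseudolimit is colimit if its projections are. -/
noncomputable def isColimitOfProj {T : K ⥤ ConicalPseudolimit H} (c : Cocone T)
    (hc : ∀ γ, IsColimit ((proj H γ).mapCocone c)) : IsColimit c where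
  desc s := homMk (fun γ ↦ (hc γ).desc ((proj H γ).mapCocone s)) (fun γ δ a ↦
    (isColimitOfPreserves (H.map a).toFunctor (hc γ)).hom_ext fun i ↦ by
      have h₁ := (hc γ).fac ((proj H γ).mapCocone s) i
      have h₂ := (hc δ).fac ((proj H δ).mapCocone s) i
      have h₃ := str_naturality (c.ι.app i) a
      have h₄ := str_naturality (s.ι.app i) a
      dsimp at h₁ h₂ h₃ h₄ ⊢
      rw [← reassoc_of% h₃, h₂, ← Functor.map_comp_assoc, h₁, h₄])
  fac s i := hom_ext fun γ ↦ by
    rw [Functor.map_comp]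
    exact (hc γ).fac ((proj H γ).mapCocone s) i
  uniq s m hm := hom_ext fun γ ↦ (hc γ).uniq ((proj H γ).mapCocone s) _ fun i ↦ by
    dsimp
    rw [← Functor.map_comp, hm]

variable {T : K ⥤ ConicalPseudolimit H} {c : ∀ γ, Cocone (T ⋙ proj H γ)}
  (hc : ∀ γ, IsColimit (c γ))

/-- The gluing data given by a diagram in the conical pseudolimit and colimits of its
projections. -/
noncomputable def gluingDataOfDiagram (c : ∀ γ, Cocone (T ⋙ proj H γ)) : GluingData c where
  fwd {γ δ} a i := (T.obj i).str a ≫ (c δ).ι.app i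
  bwd {γ δ} a i := inv ((T.obj i).str a) ≫ (H.map a).toFunctor.map ((c γ).ι.app i)
  fwd_naturality {γ δ} a {i j} k := by
    dsimp
    rw [← reassoc_of% str_naturality]
    exact congrArg _ ((c δ).w k)
  bwd_naturality {γ δ} a {i j} k := by
    rw [IsIso.eq_inv_comp, ← (c γ).w k, Functor.map_comp]
    dsimp
    rw [reassoc_of% str_naturality, IsIso.hom_inv_id_assoc]
  fwd_id γ i := by rw [str_id]; rfl
  fwd_comp a b s hs i := by
    rw [str_comp, Functor.map_comp]
    simp only [Category.assoc]
    exact congrArg _ (congrArg _ (hs i).symm)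
  fwd_two t i := by
    rw [← str_two _ t]
    simp
  fwd_bwd a r hr i := by rw [Category.assoc, hr, IsIso.hom_inv_id_assoc]
  bwd_fwd a s hs i := by rw [Category.assoc, hs, IsIso.inv_hom_id_assoc]

/-- The cocone in the conical pseudolimit with given colimit projections. -/
noncomputable def coconeOfProj : Cocone T where
  pt := (gluingDataOfDiagram c).glue hc
  ι :=
    { app := fun i ↦ homMk (fun γ ↦ (c γ).ι.app i) (fun _ _ a ↦
        ((gluingDataOfDiagram c).map_ι_glue_str hc a i).symm)
      naturality := fun _ _ k ↦ hom_ext fun γ ↦ ((c γ).w k).trans (Category.comp_id _).symm }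

/-- The projections of `coconeOfProj` are the given colimit cocones. -/
noncomputable def isColimitMapCoconeOfProj (γ : Γ) :
    IsColimit ((proj H γ).mapCocone (coconeOfProj hc)) :=
  (hc γ).ofIsoColimit (Cocone.ext (Iso.refl _) fun _ ↦ Category.comp_id _)

variable (H K) in
lemma hasColimitsOfShape [∀ γ, HasColimitsOfShape K (H.obj γ)] :
    HasColimitsOfShape K (ConicalPseudolimit H) where
  has_colimit T := ⟨⟨_, isColimitOfProj _ (isColimitMapCoconeOfProj
    fun γ ↦ colimit.isColimit (T ⋙ proj H γ))⟩⟩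

variable (H K) in
lemma preservesColimitsOfShape_proj [∀ γ, HasColimitsOfShape K (H.obj γ)] (γ : Γ) :
    PreservesColimitsOfShape K (proj H γ) where
  preservesColimit {T} :=
    have hc := isColimitMapCoconeOfProj fun γ ↦ colimit.isColimit (T ⋙ proj H γ)
    preservesColimit_of_preserves_colimit_cocone (isColimitOfProj _ hc) (hc γ)

end Colimits

end ConicalPseudolimit

end

/-! ### Componentwise presentable objects are presentable -/

section

variable {Γ : Type w} [Bicategory.{w, w} Γ]

namespace IsCardinalSmallTwoCategory

variable {κ : Cardinal.{w}} (hΓ : IsCardinalSmallTwoCategory Γ κ)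

include hΓ

lemma hom (γ δ : Γ) : HasCardinalLT (γ ⟶ δ) κ :=
  hΓ.oneCells.of_injective (fun a ↦ ⟨γ, δ, a⟩) fun a b h ↦ by simpa using h

lemma hom₂ {γ δ : Γ} (a b : γ ⟶ δ) : HasCardinalLT (a ⟶ b) κ :=
  hΓ.twoCells.of_injective (fun t ↦ ⟨γ, δ, a, b, t⟩) fun s t h ↦ by simpa using h

end IsCardinalSmallTwoCategory

variable [Bicategory.Strict Γ]

namespace ConicalPseudolimit

variable {H : StrictPseudofunctor Γ Cat.{w, u}} {κ : Cardinal.{w}} [Fact κ.IsRegular]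

/-- Factor each component through the diagram, then correct the compatibility squares by moving
further along it. There are fewer than `κ` components and squares, so one index serves for all. The
square of `a` starts at `H(a)(S_γ)`, which is why `H a` must preserve presentability. -/
lemma isCardinalPresentable_of_proj (hΓ : IsCardinalSmallTwoCategory Γ κ)
    (hC : ∀ γ, HasCardinalFilteredColimits (H.obj γ) κ)
    (hH : ∀ ⦃γ δ : Γ⦄ (a : γ ⟶ δ), (H.map a).toFunctor.IsCardinalAccessible κ)
    (hH' : ∀ ⦃γ δ : Γ⦄ (a : γ ⟶ δ) (X : H.obj γ), IsCardinalPresentable X κ →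
      IsCardinalPresentable ((H.map a).toFunctor.obj X) κ)
    (S : ConicalPseudolimit H) (hS : ∀ γ, IsCardinalPresentable ((proj H γ).obj S) κ) :
    IsCardinalPresentable S κ := by
  refine ⟨fun J _ _ ↦ ⟨fun {T} ↦ ?_⟩⟩
  have (γ δ : Γ) (a : γ ⟶ δ) : PreservesColimitsOfShape J (H.map a).toFunctor :=
    (H.map a).toFunctor.preservesColimitsOfShape_of_isCardinalAccessible κ J
  have (γ : Γ) : HasColimitsOfShape J (H.obj γ) :=
    HasCardinalFilteredColimits.hasColimitsOfShape _ κ J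
  have (γ δ : Γ) (a : γ ⟶ δ) :
      IsCardinalPresentable ((H.map a).toFunctor.obj ((proj H γ).obj S)) κ :=
    hH' a _ (hS γ)
  have := isFiltered_of_isCardinalFiltered J κ
  have hc := isColimitMapCoconeOfProj fun γ ↦ colimit.isColimit (T ⋙ proj H γ)
  set c := coconeOfProj fun γ ↦ colimit.isColimit (T ⋙ proj H γ)
  refine preservesColimit_of_preserves_colimit_cocone (isColimitOfProj _ hc)
    (Types.FilteredColimit.isColimitOf' _ _ (fun f ↦ ?_) (fun j f g hfg ↦ ?_))
  · change S ⟶ c.pt at f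
    have h₁ (γ : Γ) : ∃ (j : J) (g : (proj H γ).obj S ⟶ (proj H γ).obj (T.obj j)),
        g ≫ (proj H γ).map (c.ι.app j) = (proj H γ).map f :=
      IsCardinalPresentable.exists_hom_of_isColimit κ (hc γ) ((proj H γ).map f)
    choose j g hg using h₁
    let j₀ := IsCardinalFiltered.max j hΓ.objects
    let g₀ (γ : Γ) : (proj H γ).obj S ⟶ (proj H γ).obj (T.obj j₀) :=
      g γ ≫ (proj H γ).map (T.map (IsCardinalFiltered.toMax j hΓ.objects γ))
    have hg₀ (γ : Γ) : g₀ γ ≫ (proj H γ).map (c.ι.app j₀) = (proj H γ).map f := by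
      rw [Category.assoc, ← Functor.map_comp, c.w, hg]
    -- The components of the lift need not form a morphism yet: each square commutes only in the
    -- colimit, hence at some later index.
    have h₂ (x : Σ (γ δ : Γ), (γ ⟶ δ)) : ∃ (k : J) (l : j₀ ⟶ k),
        (S.str x.2.2 ≫ g₀ x.2.1) ≫ (proj H x.2.1).map (T.map l) =
          ((H.map x.2.2).toFunctor.map (g₀ x.1) ≫ (T.obj j₀).str x.2.2) ≫
            (proj H x.2.1).map (T.map l) := by
      obtain ⟨γ, δ, a⟩ := x
      refine IsCardinalPresentable.exists_eq_of_isColimit' κ (hc δ) _ _ ?_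
      change (S.str a ≫ g₀ δ) ≫ (proj H δ).map (c.ι.app j₀) =
        ((H.map a).toFunctor.map (g₀ γ) ≫ (T.obj j₀).str a) ≫ (proj H δ).map (c.ι.app j₀)
      rw [Category.assoc, hg₀, Category.assoc, str_naturality, str_naturality,
        ← Functor.map_comp_assoc, hg₀]
      rfl
    choose k l hl using h₂
    obtain ⟨m, v, b, hb⟩ := IsCardinalFiltered.wideSpan l hΓ.oneCells
    refine ⟨m, homMk (fun γ ↦ g₀ γ ≫ (proj H γ).map (T.map b)) (fun γ δ a ↦ ?_),
      hom_ext fun γ ↦ ?_⟩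
    · have := hl ⟨γ, δ, a⟩ =≫ (proj H δ).map (T.map (v ⟨γ, δ, a⟩))
      simp only [Category.assoc, ← Functor.map_comp, hb] at this
      rw [this, str_naturality, ← Functor.map_comp_assoc]
    · change (proj H γ).map f = (proj H γ).map (homMk _ _ ≫ c.ι.app m)
      rw [Functor.map_comp, proj_map_homMk, Category.assoc, ← Functor.map_comp, c.w, hg₀]
  · change S ⟶ T.obj j at f g
    replace hfg : f ≫ c.ι.app j = g ≫ c.ι.app j := hfg
    have h₁ (γ : Γ) : ∃ (k : J) (l : j ⟶ k),
        (proj H γ).map f ≫ (proj H γ).map (T.map l) =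
          (proj H γ).map g ≫ (proj H γ).map (T.map l) := by
      refine IsCardinalPresentable.exists_eq_of_isColimit' κ (hc γ) _ _ ?_
      change (proj H γ).map f ≫ (proj H γ).map (c.ι.app j) =
        (proj H γ).map g ≫ (proj H γ).map (c.ι.app j)
      rw [← Functor.map_comp, hfg, Functor.map_comp]
    choose k l hl using h₁
    obtain ⟨m, v, b, hb⟩ := IsCardinalFiltered.wideSpan l hΓ.objects
    refine ⟨m, b, hom_ext fun γ ↦ ?_⟩
    change (proj H γ).map (f ≫ T.map b) = (proj H γ).map (g ≫ T.map b)
    rw [← hb γ, T.map_comp]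
    simp only [Functor.map_comp]
    rw [reassoc_of% hl γ]

end ConicalPseudolimit

end

/-! ### Statements holding eventually along a directed presentation -/

namespace CategoryTheory.IsCardinalFiltered

open Filter

/-- By `κ`-directedness, `atTop` is closed under intersections of fewer than `κ` sets. Conditions
for the separate cells of `Γ` can therefore be imposed simultaneously. -/
lemma eventually_forall {J : Type u₁} [PartialOrder J] {κ : Cardinal.{w}} [Fact κ.IsRegular]
    [IsCardinalFiltered J κ] {A : Type*} (hA : HasCardinalLT A κ) {P : A → J → Prop}
    (h : ∀ a, ∀ᶠ j in atTop, P a j) : ∀ᶠ j in atTop, ∀ a, P a j := by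
  have := isFiltered_of_isCardinalFiltered J κ
  have := IsFiltered.isDirectedOrder J
  have := IsFiltered.nonempty (C := J)
  simp only [eventually_atTop] at h ⊢
  choose b hb using h
  exact ⟨IsCardinalFiltered.max b hA, fun j hj a ↦
    hb a j ((leOfHom (IsCardinalFiltered.toMax b hA a)).trans hj)⟩

end CategoryTheory.IsCardinalFiltered

namespace CategoryTheory.Limits.ColimitPresentation

open Filter

variable {C : Type u} [Category.{v} C] {D : Type u₁} [Category.{v₁} D] {J : Type w} [PartialOrder J]
  {X : C} (p : ColimitPresentation J X)

/-- The transition morphisms of a presentation of a colimit indexed by a partially ordered set. -/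
def tr {j k : J} (h : j ≤ k) : p.diag.obj j ⟶ p.diag.obj k := p.diag.map (homOfLE h)

/-- The morphisms from the terms of a presentation to the colimit. -/
def incl (j : J) : p.diag.obj j ⟶ X := p.ι.app j

@[simp]
lemma tr_self (j : J) : p.tr (le_refl j) = 𝟙 _ := p.diag.map_id j

@[simp]
lemma tr_tr {i j k : J} (h : i ≤ j) (h' : j ≤ k) : p.tr h ≫ p.tr h' = p.tr (h.trans h') :=
  (p.diag.map_comp _ _).symm

@[simp]
lemma tr_tr_assoc {i j k : J} (h : i ≤ j) (h' : j ≤ k) {Z : C} (f : p.diag.obj k ⟶ Z) :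
    p.tr h ≫ p.tr h' ≫ f = p.tr (h.trans h') ≫ f := by
  rw [← Category.assoc, tr_tr]

@[simp]
lemma tr_incl {j k : J} (h : j ≤ k) : p.tr h ≫ p.incl k = p.incl j := p.w _

@[simp]
lemma tr_incl_assoc {j k : J} (h : j ≤ k) {Z : C} (f : X ⟶ Z) :
    p.tr h ≫ p.incl k ≫ f = p.incl j ≫ f := by
  rw [← Category.assoc, tr_incl]

@[simp]
lemma map_tr_incl (F : C ⥤ D) {j k : J} (h : j ≤ k) :
    F.map (p.tr h) ≫ F.map (p.incl k) = F.map (p.incl j) := by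
  rw [← F.map_comp, tr_incl]

@[simp]
lemma map_tr_incl_assoc (F : C ⥤ D) {j k : J} (h : j ≤ k) {Z : D} (f : F.obj X ⟶ Z) :
    F.map (p.tr h) ≫ F.map (p.incl k) ≫ f = F.map (p.incl j) ≫ f := by
  rw [← Category.assoc, map_tr_incl]

variable {κ : Cardinal.{w}} [Fact κ.IsRegular] [IsCardinalFiltered J κ]

variable (κ) in
lemma eventually_exists_hom {Q : C} [IsCardinalPresentable Q κ] (f : Q ⟶ X) :
    ∀ᶠ j in atTop, ∃ g : Q ⟶ p.diag.obj j, g ≫ p.incl j = f := by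
  obtain ⟨j, g, hg⟩ := IsCardinalPresentable.exists_hom_of_isColimit κ p.isColimit f
  filter_upwards [eventually_ge_atTop j] with k hk
  exact ⟨g ≫ p.tr hk, by rw [Category.assoc, tr_incl]; exact hg⟩

variable (κ) in
-- The inequalities are universally quantified inside the filter statement so that it makes sense
-- for every `k`; they are supplied once a single large index has been chosen.
lemma eventually_eq {Q : C} [IsCardinalPresentable Q κ] {i j : J} (f : Q ⟶ p.diag.obj i)
    (g : Q ⟶ p.diag.obj j) (h : f ≫ p.incl i = g ≫ p.incl j) :
    ∀ᶠ k in atTop, ∀ (hi : i ≤ k) (hj : j ≤ k), f ≫ p.tr hi = g ≫ p.tr hj := by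
  obtain ⟨k, u, v, huv⟩ := IsCardinalPresentable.exists_eq_of_isColimit κ p.isColimit f g h
  filter_upwards [eventually_ge_atTop k] with l hl hi hj
  rw [← p.tr_tr (leOfHom u) hl, ← p.tr_tr (leOfHom v) hl]
  rw [← Category.assoc, ← Category.assoc]
  exact huv =≫ p.tr hl

lemma map_incl (F : C ⥤ D) [PreservesColimitsOfShape J F] (j : J) :
    (p.map F).incl j = F.map (p.incl j) := by
  simp [incl]
  rfl

variable (κ) in
lemma eventually_exists_hom_map (F : C ⥤ D) [PreservesColimitsOfShape J F] {Q : D}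
    [IsCardinalPresentable Q κ] (f : Q ⟶ F.obj X) :
    ∀ᶠ j in atTop, ∃ g : Q ⟶ F.obj (p.diag.obj j), g ≫ F.map (p.incl j) = f := by
  simp only [← map_incl]
  exact (p.map F).eventually_exists_hom κ f

variable (κ) in
lemma eventually_map_eq (F : C ⥤ D) [PreservesColimitsOfShape J F] {Q : D}
    [IsCardinalPresentable Q κ] {i j : J} (f : Q ⟶ F.obj (p.diag.obj i))
    (g : Q ⟶ F.obj (p.diag.obj j)) (h : f ≫ F.map (p.incl i) = g ≫ F.map (p.incl j)) :
    ∀ᶠ k in atTop, ∀ (hi : i ≤ k) (hj : j ≤ k),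
      f ≫ F.map (p.tr hi) = g ≫ F.map (p.tr hj) :=
  (p.map F).eventually_eq κ f g (by rwa [map_incl, map_incl])

end CategoryTheory.Limits.ColimitPresentation

/-! ### Stages: delayed approximations of the structure isomorphisms -/

section

variable {Γ : Type w} [Bicategory.{w, w} Γ] [Bicategory.Strict Γ]

namespace ConicalPseudolimit

open Filter

variable {H : StrictPseudofunctor Γ Cat.{w, u}} {κ : Cardinal.{w}} [Fact κ.IsRegular]
  {E : ConicalPseudolimit H} {J : Type w} [PartialOrder J]
  (p : ∀ γ, ColimitPresentation J ((proj H γ).obj E))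

/-- An approximation of the structure isomorphisms of an object `E` of the conical pseudolimit
by morphisms between terms of presentations of its components. -/
structure Stage where
  /-- the index of the sources of the morphisms -/
  src : J
  /-- the index of the targets of the morphisms -/
  tgt : J
  le : src ≤ tgt
  /-- the approximation of the structure isomorphisms -/
  fwd {γ δ : Γ} (a : γ ⟶ δ) :
    (H.map a).toFunctor.obj ((p γ).diag.obj src) ⟶ (p δ).diag.obj tgt
  /-- the approximation of the inverses of the structure isomorphisms -/
  bwd {γ δ : Γ} (a : γ ⟶ δ) :
    (p δ).diag.obj src ⟶ (H.map a).toFunctor.obj ((p γ).diag.obj tgt)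
  fwd_incl {γ δ : Γ} (a : γ ⟶ δ) :
    fwd a ≫ (p δ).incl tgt = (H.map a).toFunctor.map ((p γ).incl src) ≫ E.str a
  bwd_incl {γ δ : Γ} (a : γ ⟶ δ) :
    bwd a ≫ (H.map a).toFunctor.map ((p γ).incl tgt) = (p δ).incl src ≫ inv (E.str a)

namespace Stage

variable {p}

/-- Enlarging the target of a stage. -/
def raise (m : Stage p) {k : J} (h : m.tgt ≤ k) : Stage p where
  src := m.src
  tgt := k
  le := m.le.trans h
  fwd a := m.fwd a ≫ (p _).tr h
  bwd a := m.bwd a ≫ (H.map a).toFunctor.map ((p _).tr h)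
  fwd_incl a := by simp [m.fwd_incl]
  bwd_incl a := by simp [m.bwd_incl]

/-- The relation between stages saying that the second one extends the first one, and that all the
equations between structure isomorphisms hold up to passing from the first stage to the second. -/
structure Prec (m m' : Stage p) : Prop where
  tgt_le : m.tgt ≤ m'.src
  fwd_naturality {γ δ : Γ} (a : γ ⟶ δ) :
    (H.map a).toFunctor.map ((p γ).tr (m.le.trans tgt_le)) ≫ m'.fwd a =
      m.fwd a ≫ (p δ).tr (tgt_le.trans m'.le)
  bwd_naturality {γ δ : Γ} (a : γ ⟶ δ) :
    (p δ).tr (m.le.trans tgt_le) ≫ m'.bwd a =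
      m.bwd a ≫ (H.map a).toFunctor.map ((p γ).tr (tgt_le.trans m'.le))
  -- The coherence equations are needed for `fwd` only, since `bwd` serves just to invert it.
  fwd_id (γ : Γ) : m.fwd (𝟙 γ) ≫ (p γ).tr (tgt_le.trans m'.le) =
    H.idApp γ _ ≫ (p γ).tr (m.le.trans (tgt_le.trans m'.le))
  fwd_comp {γ δ θ : Γ} (a : γ ⟶ δ) (b : δ ⟶ θ) :
    m.fwd (a ≫ b) ≫ (p θ).tr (tgt_le.trans m'.le) =
      H.compApp a b _ ≫ (H.map b).toFunctor.map (m.fwd a ≫ (p δ).tr tgt_le) ≫ m'.fwd b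
  fwd_two {γ δ : Γ} {a b : γ ⟶ δ} (t : a ⟶ b) :
    (H.twoApp t _ ≫ m.fwd b) ≫ (p δ).tr (tgt_le.trans m'.le) =
      m.fwd a ≫ (p δ).tr (tgt_le.trans m'.le)
  fwd_bwd {γ δ : Γ} (a : γ ⟶ δ) :
    m.fwd a ≫ (p δ).tr tgt_le ≫ m'.bwd a =
      (H.map a).toFunctor.map ((p γ).tr (m.le.trans (tgt_le.trans m'.le)))
  bwd_fwd {γ δ : Γ} (a : γ ⟶ δ) :
    m.bwd a ≫ (H.map a).toFunctor.map ((p γ).tr tgt_le) ≫ m'.fwd a =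
      (p δ).tr (m.le.trans (tgt_le.trans m'.le))

variable [IsCardinalFiltered J κ] (hΓ : IsCardinalSmallTwoCategory Γ κ)
  [∀ (γ δ : Γ) (a : γ ⟶ δ), PreservesColimitsOfShape J (H.map a).toFunctor]
  [hp : ∀ γ j, IsCardinalPresentable ((p γ).diag.obj j) κ]
  [hHp : ∀ (γ δ : Γ) (a : γ ⟶ δ) (j : J),
    IsCardinalPresentable ((H.map a).toFunctor.obj ((p γ).diag.obj j)) κ]

include hΓ

variable (p) in
-- The terms at `j` and their images under `H a` are `κ`-presentable, so each of the fewer than `κ`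
-- morphisms into a colimit factors through a term, and a common target can be chosen.
lemma exists_src_eq (j : J) : ∃ m : Stage p, m.src = j := by
  have := isFiltered_of_isCardinalFiltered J κ
  have := IsFiltered.isDirectedOrder J
  have := IsFiltered.nonempty (C := J)
  have h₁ : ∀ᶠ k in atTop, ∀ γ δ (a : γ ⟶ δ),
      ∃ g : (H.map a).toFunctor.obj ((p γ).diag.obj j) ⟶ (p δ).diag.obj k,
        g ≫ (p δ).incl k = (H.map a).toFunctor.map ((p γ).incl j) ≫ E.str a :=
    IsCardinalFiltered.eventually_forall hΓ.objects fun γ ↦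
      IsCardinalFiltered.eventually_forall hΓ.objects fun δ ↦
        IsCardinalFiltered.eventually_forall (hΓ.hom γ δ) fun a ↦
          (p δ).eventually_exists_hom κ _
  have h₂ : ∀ᶠ k in atTop, ∀ γ δ (a : γ ⟶ δ),
      ∃ g : (p δ).diag.obj j ⟶ (H.map a).toFunctor.obj ((p γ).diag.obj k),
        g ≫ (H.map a).toFunctor.map ((p γ).incl k) = (p δ).incl j ≫ inv (E.str a) :=
    IsCardinalFiltered.eventually_forall hΓ.objects fun γ ↦
      IsCardinalFiltered.eventually_forall hΓ.objects fun δ ↦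
        IsCardinalFiltered.eventually_forall (hΓ.hom γ δ) fun a ↦
          (p γ).eventually_exists_hom_map κ _ _
  obtain ⟨k, hk, h₁, h₂⟩ := ((eventually_ge_atTop j).and (h₁.and h₂)).exists
  choose f hf using h₁
  choose g hg using h₂
  exact ⟨⟨j, k, hk, fun a ↦ f _ _ a, fun a ↦ g _ _ a, fun a ↦ hf _ _ a, fun a ↦ hg _ _ a⟩, rfl⟩

/-- Every equation in `Prec` becomes true after mapping to `E`, where it is an equation between the
actual structure isomorphisms. By presentability it is already true at some later index. -/
lemma eventually_prec_raise (m m' : Stage p) (h : m.tgt ≤ m'.src) :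
    ∀ᶠ k in atTop, ∀ h' : m'.tgt ≤ k, m.Prec (m'.raise h') := by
  have h₁ : ∀ᶠ k in atTop, ∀ γ δ (a : γ ⟶ δ) (h₁ : m'.tgt ≤ k) (h₂ : m.tgt ≤ k),
      ((H.map a).toFunctor.map ((p γ).tr (m.le.trans h)) ≫ m'.fwd a) ≫ (p δ).tr h₁ =
        m.fwd a ≫ (p δ).tr h₂ :=
    IsCardinalFiltered.eventually_forall hΓ.objects fun γ ↦
      IsCardinalFiltered.eventually_forall hΓ.objects fun δ ↦
        IsCardinalFiltered.eventually_forall (hΓ.hom γ δ) fun a ↦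
          (p δ).eventually_eq κ _ _ (by simp [fwd_incl])
  have h₂ : ∀ᶠ k in atTop, ∀ γ δ (a : γ ⟶ δ) (h₁ : m'.tgt ≤ k) (h₂ : m.tgt ≤ k),
      ((p δ).tr (m.le.trans h) ≫ m'.bwd a) ≫ (H.map a).toFunctor.map ((p γ).tr h₁) =
        m.bwd a ≫ (H.map a).toFunctor.map ((p γ).tr h₂) :=
    IsCardinalFiltered.eventually_forall hΓ.objects fun γ ↦
      IsCardinalFiltered.eventually_forall hΓ.objects fun δ ↦
        IsCardinalFiltered.eventually_forall (hΓ.hom γ δ) fun a ↦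
          (p γ).eventually_map_eq κ _ ((p δ).tr (m.le.trans h) ≫ m'.bwd a) (m.bwd a)
            (by simp [bwd_incl])
  have h₃ : ∀ᶠ k in atTop, ∀ γ (h₁ : m.tgt ≤ k) (h₂ : m.src ≤ k),
      m.fwd (𝟙 γ) ≫ (p γ).tr h₁ = H.idApp γ _ ≫ (p γ).tr h₂ :=
    IsCardinalFiltered.eventually_forall hΓ.objects fun γ ↦
      (p γ).eventually_eq κ _ _ (by rw [fwd_incl, str_id, H.idApp_naturality])
  have h₄ : ∀ᶠ k in atTop, ∀ γ δ (a : γ ⟶ δ) θ (b : δ ⟶ θ) (h₁ : m.tgt ≤ k) (h₂ : m'.tgt ≤ k),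
      m.fwd (a ≫ b) ≫ (p θ).tr h₁ =
        (H.compApp a b _ ≫ (H.map b).toFunctor.map (m.fwd a ≫ (p δ).tr h) ≫ m'.fwd b) ≫
          (p θ).tr h₂ :=
    IsCardinalFiltered.eventually_forall hΓ.objects fun γ ↦
      IsCardinalFiltered.eventually_forall hΓ.objects fun δ ↦
        IsCardinalFiltered.eventually_forall (hΓ.hom γ δ) fun a ↦
          IsCardinalFiltered.eventually_forall hΓ.objects fun θ ↦
            IsCardinalFiltered.eventually_forall (hΓ.hom δ θ) fun b ↦
              (p θ).eventually_eq κ _ _ (by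
                rw [fwd_incl, str_comp, reassoc_of% H.compApp_naturality]
                simp only [Category.assoc, fwd_incl]
                rw [← Functor.map_comp_assoc, ← Functor.map_comp_assoc, Category.assoc,
                  ColimitPresentation.tr_incl, fwd_incl])
  have h₅ : ∀ᶠ k in atTop, ∀ γ δ (a b : γ ⟶ δ) (t : a ⟶ b) (h₁ h₂ : m.tgt ≤ k),
      (H.twoApp t _ ≫ m.fwd b) ≫ (p δ).tr h₁ = m.fwd a ≫ (p δ).tr h₂ :=
    IsCardinalFiltered.eventually_forall hΓ.objects fun γ ↦
      IsCardinalFiltered.eventually_forall hΓ.objects fun δ ↦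
        IsCardinalFiltered.eventually_forall (hΓ.hom γ δ) fun a ↦
          IsCardinalFiltered.eventually_forall (hΓ.hom γ δ) fun b ↦
            IsCardinalFiltered.eventually_forall (hΓ.hom₂ a b) fun t ↦
              (p δ).eventually_eq κ _ _ (by
                rw [Category.assoc, fwd_incl, fwd_incl, ← str_two _ t,
                  reassoc_of% H.twoApp_naturality])
  -- The identity on the right gives both sides the form of a morphism followed by a transition, as
  -- `eventually_map_eq` requires.
  have h₆ : ∀ᶠ k in atTop, ∀ γ δ (a : γ ⟶ δ) (h₁ : m'.tgt ≤ k) (h₂ : m.src ≤ k),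
      (m.fwd a ≫ (p δ).tr h ≫ m'.bwd a) ≫ (H.map a).toFunctor.map ((p γ).tr h₁) =
        𝟙 _ ≫ (H.map a).toFunctor.map ((p γ).tr h₂) :=
    IsCardinalFiltered.eventually_forall hΓ.objects fun γ ↦
      IsCardinalFiltered.eventually_forall hΓ.objects fun δ ↦
        IsCardinalFiltered.eventually_forall (hΓ.hom γ δ) fun a ↦
          (p γ).eventually_map_eq κ _ (m.fwd a ≫ (p δ).tr h ≫ m'.bwd a) (𝟙 _) (by simp [bwd_incl, reassoc_of% fwd_incl])
  have h₇ : ∀ᶠ k in atTop, ∀ γ δ (a : γ ⟶ δ) (h₁ : m'.tgt ≤ k) (h₂ : m.src ≤ k),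
      (m.bwd a ≫ (H.map a).toFunctor.map ((p γ).tr h) ≫ m'.fwd a) ≫ (p δ).tr h₁ =
        𝟙 _ ≫ (p δ).tr h₂ :=
    IsCardinalFiltered.eventually_forall hΓ.objects fun γ ↦
      IsCardinalFiltered.eventually_forall hΓ.objects fun δ ↦
        IsCardinalFiltered.eventually_forall (hΓ.hom γ δ) fun a ↦
          (p δ).eventually_eq κ _ _ (by simp [reassoc_of% bwd_incl, fwd_incl])
  filter_upwards [h₁, h₂, h₃, h₄, h₅, h₆, h₇] with k h₁ h₂ h₃ h₄ h₅ h₆ h₇ h'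
  exact
    { tgt_le := h
      fwd_naturality := fun a ↦ (Category.assoc _ _ _).symm.trans (h₁ _ _ a h' _)
      bwd_naturality := fun a ↦ (Category.assoc _ _ _).symm.trans (h₂ _ _ a h' _)
      fwd_id := fun γ ↦ h₃ γ _ _
      fwd_comp := fun a b ↦ 
        (h₄ _ _ a _ b _ h').trans (by simp only [Category.assoc]; rfl)
      fwd_two := fun t ↦ h₅ _ _ _ _ t _ _
      fwd_bwd := fun a ↦ 
        Eq.trans (by simp only [Category.assoc]; rfl) ((h₆ _ _ a h' _).trans (Category.id_comp _))
      bwd_fwd := fun a ↦ 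
        Eq.trans (by simp only [Category.assoc]; rfl)
          ((h₇ _ _ a h' _).trans (Category.id_comp _)) }

/-- Take a stage whose source lies beyond all the given targets, then raise its target until all
equations hold. -/
lemma exists_forall_prec {A : Type*} (hA : HasCardinalLT A κ) (s : A → Stage p) :
    ∃ m, ∀ a, (s a).Prec m := by
  have := isFiltered_of_isCardinalFiltered J κ
  have := IsFiltered.isDirectedOrder J
  have := IsFiltered.nonempty (C := J)
  obtain ⟨j, hj⟩ := (IsCardinalFiltered.eventually_forall hA
    fun a ↦ eventually_ge_atTop (s a).tgt).exists
  obtain ⟨m, rfl⟩ := exists_src_eq p hΓ j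
  obtain ⟨k, hk, h⟩ := ((eventually_ge_atTop m.tgt).and (IsCardinalFiltered.eventually_forall hA
    fun a ↦ eventually_prec_raise hΓ (s a) m (hj a))).exists
  exact ⟨m.raise hk, fun a ↦ h a hk⟩

end Stage

end ConicalPseudolimit

end

/-! ### Cardinality bounds and transfinite chains -/

lemma hasCardinalLT_toType_ord {c κ : Cardinal.{w}} (h : c < κ) : HasCardinalLT c.ord.ToType κ := by
  rwa [hasCardinalLT_iff_cardinal_mk_lt, Cardinal.mk_ord_toType]

lemma hasCardinalLT_arrow_of_preorder {K : Type w} [Preorder K] {κ : Cardinal.{w}}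
    (hκ : Cardinal.aleph0 ≤ κ) (h : HasCardinalLT K κ) : HasCardinalLT (Arrow K) κ :=
  (hasCardinalLT_prod hκ h h).of_injective (fun f ↦ (f.left, f.right)) (by
    rintro ⟨x, y, f⟩ ⟨x', y', f'⟩ h
    obtain ⟨rfl, rfl⟩ := Prod.ext_iff.1 h
    obtain rfl : f = f' := Subsingleton.elim _ _
    rfl)

/-- If every small family has an upper bound for a relation `r`, then there are `r`-increasing
sequences indexed by small well-ordered types, all of whose terms are `r`-above a given element. -/
lemma exists_chain_of_forall_exists_upper_bound {M : Type u} {r : M → M → Prop} {κ : Cardinal.{w}}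
    (hκ : Cardinal.aleph0 ≤ κ)
    (hr : ∀ (A : Type w) (_ : HasCardinalLT A κ) (s : A → M), ∃ m, ∀ a, r (s a) m)
    (K : Type w) [LinearOrder K] [WellFoundedLT K] (hK : HasCardinalLT K κ) (m₀ : M) :
    ∃ σ : K → M, (∀ i, r m₀ (σ i)) ∧ ∀ i j, i < j → r (σ i) (σ j) := by
  -- The term at `i` bounds all earlier terms together with `m₀`, which is indexed by `none`.
  have hK' (i : K) : HasCardinalLT (Option { j : K // j < i }) κ := by
    rw [hasCardinalLT_option_iff _ _ hκ]
    exact hK.of_injective _ Subtype.val_injective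
  choose ub hub using hr
  let prev (i : K) (f : ∀ j, j < i → M) (o : Option { j : K // j < i }) : M :=
    o.elim m₀ (fun j ↦ f j.1 j.2)
  let step (i : K) (f : ∀ j, j < i → M) : M := ub _ (hK' i) (prev i f)
  let σ : K → M := wellFounded_lt.fix step
  have hσ (i : K) : σ i = step i (fun j _ ↦ σ j) := wellFounded_lt.fix_eq step i
  refine ⟨σ, fun i ↦ ?_, fun j i h ↦ ?_⟩
  · rw [hσ i]
    exact hub _ (hK' i) (prev i fun j _ ↦ σ j) none
  · rw [hσ i]
    exact hub _ (hK' i) (prev i fun j _ ↦ σ j) (some ⟨j, h⟩)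

/-! ### The colimit of a chain of stages -/

section

variable {Γ : Type w} [Bicategory.{w, w} Γ] [Bicategory.Strict Γ]

namespace ConicalPseudolimit

variable {H : StrictPseudofunctor Γ Cat.{w, u}}
  {E : ConicalPseudolimit H} {J : Type w} [PartialOrder J]
  {p : ∀ γ, ColimitPresentation J ((proj H γ).obj E)}

namespace Stage

section Chain

variable {K : Type w} [LinearOrder K] {σ : K → Stage p} (hσ : ∀ i j, i < j → (σ i).Prec (σ j))

include hσ in
lemma src_mono {i j : K} (h : i ≤ j) : (σ i).src ≤ (σ j).src := by
  obtain rfl | h := h.eq_or_lt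
  · exact le_rfl
  · exact (σ i).le.trans (hσ i j h).tgt_le

/-- The diagram of sources of a chain of stages. -/
abbrev chain (γ : Γ) : K ⥤ H.obj γ where
  obj i := (p γ).diag.obj (σ i).src
  map f := (p γ).tr (src_mono hσ (leOfHom f))
  map_id _ := (p γ).tr_self _
  map_comp _ _ := ((p γ).tr_tr _ _).symm

variable (c : ∀ γ, Cocone (chain hσ γ))

/-- The morphism from a term of a presentation to the colimit of a chain of stages. -/
def toPt (γ : Γ) {j : J} {i : K} (h : j ≤ (σ i).src) : (p γ).diag.obj j ⟶ (c γ).pt :=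
  (p γ).tr h ≫ (c γ).ι.app i

lemma toPt_eq (γ : Γ) {j : J} {i i' : K} (h : j ≤ (σ i).src) (h' : j ≤ (σ i').src) :
    toPt hσ c γ h = toPt hσ c γ h' := by
  wlog hi : i ≤ i' generalizing i i'
  · exact (this h' h (le_of_not_ge hi)).symm
  · dsimp only [toPt]
    rw [← (c γ).w (homOfLE hi)]
    exact (p γ).tr_tr_assoc h _ _

@[simp]
lemma tr_toPt (γ : Γ) {j k : J} {i : K} (h : j ≤ k) (h' : k ≤ (σ i).src) :
    (p γ).tr h ≫ toPt hσ c γ h' = toPt hσ c γ (h.trans h') :=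
  (p γ).tr_tr_assoc h h' _

lemma toPt_self (γ : Γ) (i : K) : toPt hσ c γ (le_refl (σ i).src) = (c γ).ι.app i := by
  dsimp only [toPt]
  rw [ColimitPresentation.tr_self]
  exact Category.id_comp _

variable [NoMaxOrder K]

include hσ in
lemma exists_tgt_le (i : K) : ∃ i', (σ i).tgt ≤ (σ i').src := by
  obtain ⟨i', h⟩ := exists_gt i
  exact ⟨i', (hσ i i' h).tgt_le⟩

/-- The morphism from a target in a chain of stages to the colimit of the chain. -/
noncomputable def tgtToPt (γ : Γ) (i : K) : (p γ).diag.obj (σ i).tgt ⟶ (c γ).pt :=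
  toPt hσ c γ (exists_tgt_le hσ i).choose_spec

lemma tgtToPt_eq (γ : Γ) {i j : K} (h : (σ i).tgt ≤ (σ j).src) :
    tgtToPt hσ c γ i = toPt hσ c γ h := toPt_eq _ _ _ _ _

lemma tr_tgtToPt (γ : Γ) {j : J} {i i' : K} (h : j ≤ (σ i).tgt) (h' : j ≤ (σ i').src) :
    (p γ).tr h ≫ tgtToPt hσ c γ i = toPt hσ c γ h' :=
  (tr_toPt ..).trans (toPt_eq _ _ _ _ _)

lemma map_tr_tgtToPt {γ δ : Γ} (a : γ ⟶ δ) {j : J} {i i' : K} (h : j ≤ (σ i).tgt)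
    (h' : j ≤ (σ i').src) :
    (H.map a).toFunctor.map ((p γ).tr h) ≫ (H.map a).toFunctor.map (tgtToPt hσ c γ i) =
      (H.map a).toFunctor.map (toPt hσ c γ h') := by
  rw [← Functor.map_comp, tr_tgtToPt hσ c γ h h']

lemma fwd_tgtToPt {γ δ : Γ} (a : γ ⟶ δ) {m : Stage p} {i : K} (h : m.Prec (σ i)) :
    (H.map a).toFunctor.map ((p γ).tr (m.le.trans h.tgt_le)) ≫ (σ i).fwd a ≫
      tgtToPt hσ c δ i = m.fwd a ≫ toPt hσ c δ h.tgt_le := by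
  rw [← Category.assoc, h.fwd_naturality, Category.assoc, tr_tgtToPt]

lemma bwd_tgtToPt {γ δ : Γ} (a : γ ⟶ δ) {m : Stage p} {i : K} (h : m.Prec (σ i)) :
    (p δ).tr (m.le.trans h.tgt_le) ≫ (σ i).bwd a ≫
      (H.map a).toFunctor.map (tgtToPt hσ c γ i) =
        m.bwd a ≫ (H.map a).toFunctor.map (toPt hσ c γ h.tgt_le) := by
  rw [← Category.assoc, h.bwd_naturality, Category.assoc, map_tr_tgtToPt]

/-- The gluing data given by a chain of stages. -/
noncomputable def gluingData : GluingData c where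
  fwd {γ δ} a i := (σ i).fwd a ≫ tgtToPt hσ c δ i
  bwd {γ δ} a i := (σ i).bwd a ≫ (H.map a).toFunctor.map (tgtToPt hσ c γ i)
  fwd_naturality {γ δ} a {i j} k := by
    -- `Prec` relates only distinct terms of the chain, so identities are treated separately.
    obtain rfl | h := (leOfHom k).eq_or_lt
    · obtain rfl : k = 𝟙 i := Subsingleton.elim _ _
      rw [CategoryTheory.Functor.map_id, CategoryTheory.Functor.map_id]
      exact Category.id_comp _
    · rw [tgtToPt_eq hσ c δ (hσ i j h).tgt_le]
      exact fwd_tgtToPt hσ c a (hσ i j h)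
  bwd_naturality {γ δ} a {i j} k := by
    obtain rfl | h := (leOfHom k).eq_or_lt
    · obtain rfl : k = 𝟙 i := Subsingleton.elim _ _
      rw [CategoryTheory.Functor.map_id]
      exact Category.id_comp _
    · rw [tgtToPt_eq hσ c γ (hσ i j h).tgt_le]
      exact bwd_tgtToPt hσ c a (hσ i j h)
  fwd_id γ i := by
    -- As there is no last term, one can pass to a later stage, where the equations of `Prec` are
    -- available; the colimit absorbs the delay. The remaining coherence and inverse laws use the
    -- same device.
    obtain ⟨i', h⟩ := exists_gt i
    have h' := hσ i i' h
    rw [← toPt_self hσ c, toPt_eq hσ c γ _ (src_mono hσ h.le), tgtToPt_eq hσ c γ h'.tgt_le,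
      ← tr_tgtToPt hσ c γ (h'.tgt_le.trans (σ i').le), ← Category.assoc, h'.fwd_id, Category.assoc,
      tr_tgtToPt]
  fwd_comp {γ δ θ} a b s hs i := by
    obtain ⟨i', h⟩ := exists_gt i
    have h' := hσ i i' h
    rw [tgtToPt_eq hσ c θ h'.tgt_le, ← tr_tgtToPt hσ c θ (h'.tgt_le.trans (σ i').le),
      ← Category.assoc, h'.fwd_comp, Category.assoc, Category.assoc, ← hs,
      ← Functor.map_comp_assoc, Category.assoc, tgtToPt_eq hσ c δ h'.tgt_le]
    rfl
  fwd_two {γ δ a b} t i := by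
    obtain ⟨i', h⟩ := exists_gt i
    have h' := hσ i i' h
    rw [tgtToPt_eq hσ c δ h'.tgt_le, ← tr_tgtToPt hσ c δ (h'.tgt_le.trans (σ i').le)]
    have h₂ := h'.fwd_two t =≫ tgtToPt hσ c δ i'
    simp only [Category.assoc] at h₂
    exact h₂
  fwd_bwd {γ δ} a r hr i := by
    obtain ⟨i', h⟩ := exists_gt i
    have h' := hσ i i' h
    have h₁ : toPt hσ c δ h'.tgt_le ≫ r = (p δ).tr h'.tgt_le ≫ (σ i').bwd a ≫
        (H.map a).toFunctor.map (tgtToPt hσ c γ i') := by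
      rw [← hr]
      exact Category.assoc _ _ _
    rw [tgtToPt_eq hσ c δ h'.tgt_le, Category.assoc, h₁]
    have h₂ := h'.fwd_bwd a =≫ (H.map a).toFunctor.map (tgtToPt hσ c γ i')
    simp only [Category.assoc] at h₂
    rw [h₂, map_tr_tgtToPt hσ c a _ le_rfl, toPt_self]
  bwd_fwd {γ δ} a s hs i := by
    obtain ⟨i', h⟩ := exists_gt i
    have h' := hσ i i' h
    have h₁ : (H.map a).toFunctor.map (toPt hσ c γ h'.tgt_le) ≫ s =
        (H.map a).toFunctor.map ((p γ).tr h'.tgt_le) ≫ (σ i').fwd a ≫ tgtToPt hσ c δ i' := by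
      rw [← hs, toPt, Functor.map_comp]
      exact Category.assoc _ _ _
    rw [tgtToPt_eq hσ c γ h'.tgt_le, Category.assoc, h₁]
    have h₂ := h'.bwd_fwd a =≫ tgtToPt hσ c δ i'
    simp only [Category.assoc] at h₂
    rw [h₂, tr_tgtToPt hσ c δ _ le_rfl, toPt_self]

lemma gluingData_fwd {γ δ : Γ} (a : γ ⟶ δ) (i : K) :
    (gluingData hσ c).fwd a i = (σ i).fwd a ≫ tgtToPt hσ c δ i := rfl

/-- The cocone from the sources of a chain of stages to the given component of `E`. -/
def chainCocone (γ : Γ) : Cocone (chain hσ γ) where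
  pt := (proj H γ).obj E
  ι :=
    { app := fun i ↦ (p γ).incl (σ i).src
      naturality := fun _ _ _ ↦ ((p γ).tr_incl _).trans (Category.comp_id _).symm }

variable {c} (hc : ∀ γ, IsColimit (c γ))

/-- The morphism from the colimit of a chain of stages to the given component of `E`. -/
def chainDesc (γ : Γ) : (c γ).pt ⟶ (proj H γ).obj E := (hc γ).desc (chainCocone hσ γ)

lemma ι_chainDesc (γ : Γ) (i : K) :
    (c γ).ι.app i ≫ chainDesc hσ hc γ = (p γ).incl (σ i).src :=
  (hc γ).fac _ i

lemma toPt_chainDesc (γ : Γ) {j : J} {i : K} (h : j ≤ (σ i).src) :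
    toPt hσ c γ h ≫ chainDesc hσ hc γ = (p γ).incl j := by
  rw [toPt, Category.assoc, ι_chainDesc, ColimitPresentation.tr_incl]

lemma tgtToPt_chainDesc (γ : Γ) (i : K) :
    tgtToPt hσ c γ i ≫ chainDesc hσ hc γ = (p γ).incl (σ i).tgt :=
  toPt_chainDesc _ _ _ _

end Chain

/-- Glue the colimits of a `lam`-chain of stages lying above `m`. The last clause records that the
structure of `X` extends `m.fwd`, which later allows morphisms into the terms of the presentations
to become morphisms into `X`. -/
lemma exists_hom_of_stage (lam κ : Cardinal.{w}) [Fact κ.IsRegular]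
    (hlam : Cardinal.aleph0 ≤ lam) (hlamκ : lam < κ) (hΓ : IsCardinalSmallTwoCategory Γ κ)
    [IsCardinalFiltered J κ]
    [∀ γ, HasColimitsOfShape lam.ord.ToType (H.obj γ)]
    [∀ (γ δ : Γ) (a : γ ⟶ δ), PreservesColimitsOfShape lam.ord.ToType (H.map a).toFunctor]
    [∀ (γ δ : Γ) (a : γ ⟶ δ), PreservesColimitsOfShape J (H.map a).toFunctor]
    [hp : ∀ γ j, IsCardinalPresentable ((p γ).diag.obj j) κ]
    [hHp : ∀ (γ δ : Γ) (a : γ ⟶ δ) (j : J),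
      IsCardinalPresentable ((H.map a).toFunctor.obj ((p γ).diag.obj j)) κ] (m : Stage p) :
    ∃ (X : ConicalPseudolimit H) (π : X ⟶ E)
      (n : ∀ γ, (p γ).diag.obj m.tgt ⟶ (proj H γ).obj X),
      (∀ γ, IsCardinalPresentable ((proj H γ).obj X) κ) ∧
      (∀ γ, n γ ≫ (proj H γ).map π = (p γ).incl m.tgt) ∧
      ∀ ⦃γ δ : Γ⦄ (a : γ ⟶ δ), (H.map a).toFunctor.map ((p γ).tr m.le ≫ n γ) ≫ X.str a =
        m.fwd a ≫ n δ := by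
  have hκ : Cardinal.aleph0 ≤ κ := hlam.trans hlamκ.le
  have hK := hasCardinalLT_toType_ord hlamκ
  have := Cardinal.noMaxOrder hlam
  have : Nonempty lam.ord.ToType := by
    rw [← Cardinal.mk_ne_zero_iff, Cardinal.mk_ord_toType]
    exact (Cardinal.aleph0_pos.trans_le hlam).ne'
  obtain ⟨σ, hmσ, hσ⟩ := exists_chain_of_forall_exists_upper_bound (r := Prec (p := p)) hκ
    (fun _ hA s ↦ exists_forall_prec hΓ hA s) lam.ord.ToType hK m
  let c (γ : Γ) : Cocone (chain hσ γ) := colimit.cocone _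
  have hc (γ : Γ) : IsColimit (c γ) := colimit.isColimit _
  -- Any index will do: `m` precedes every term of the chain, without being one itself.
  have i : lam.ord.ToType := Classical.arbitrary _
  refine ⟨(gluingData hσ c).glue hc,
    (gluingData hσ c).glueDesc hc (chainDesc hσ hc) (fun γ δ a i ↦ ?_),
    fun γ ↦ toPt hσ c γ (hmσ i).tgt_le, fun γ ↦ ?_,
    fun γ ↦ toPt_chainDesc hσ hc γ (hmσ i).tgt_le, fun γ δ a ↦ ?_⟩
  · rw [gluingData_fwd, Category.assoc, tgtToPt_chainDesc, fwd_incl, ι_chainDesc]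
  · have (i) : IsCardinalPresentable ((chain hσ γ).obj i) κ := hp γ _
    exact isCardinalPresentable_of_isColimit' _ (hc γ) κ (hasCardinalLT_arrow_of_preorder hκ hK)
  · change (H.map a).toFunctor.map ((p γ).tr m.le ≫ toPt hσ c γ (hmσ i).tgt_le) ≫
      (gluingData hσ c).str hc a = m.fwd a ≫ toPt hσ c δ (hmσ i).tgt_le
    rw [← fwd_tgtToPt hσ c a (hmσ i), ← gluingData_fwd hσ c a i,
      ← (gluingData hσ c).map_ι_str hc a i, tr_toPt, toPt, Functor.map_comp, Category.assoc]

end Stage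

end ConicalPseudolimit

end

/-! ### Extending small families of objects over `E` -/

section

variable {Γ : Type w} [Bicategory.{w, w} Γ] [Bicategory.Strict Γ]

namespace ConicalPseudolimit

open Filter

variable {H : StrictPseudofunctor Γ Cat.{w, u}} {lam κ : Cardinal.{w}} [Fact κ.IsRegular]

/-- The objects of the conical pseudolimit with `κ`-presentable components. -/
def isComponentwisePresentable (H : StrictPseudofunctor Γ Cat.{w, u}) (κ : Cardinal.{w})
    [Fact κ.IsRegular] : ObjectProperty (ConicalPseudolimit H) :=
  fun S ↦ ∀ γ, IsCardinalPresentable ((proj H γ).obj S) κ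

/-- The components have presentations over different filtered categories. Reindexing along a
`κ`-directed poset mapping to their product, followed by the projections, gives a common index. -/
lemma exists_presentation (E : ConicalPseudolimit H)
    (hH : ∀ γ, IsCardinalAccessibleCategory (H.obj γ) κ) :
    ∃ (J : Type w) (_ : PartialOrder J) (_ : IsCardinalFiltered J κ)
      (p : ∀ γ, ColimitPresentation J ((proj H γ).obj E)),
      ∀ γ j, IsCardinalPresentable ((p γ).diag.obj j) κ := by
  have h (γ : Γ) := (isCardinalFilteredGenerator_isCardinalPresentable
    (H.obj γ) κ).exists_colimitsOfShape ((proj H γ).obj E)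
  choose I hI hI' hE using h
  have (γ : Γ) : IsFiltered (I γ) := isFiltered_of_isCardinalFiltered _ κ
  obtain ⟨J, _, _, F, _⟩ := IsCardinalFiltered.exists_cardinal_directed (∀ γ, I γ) κ
  exact ⟨J, inferInstance, inferInstance,
    fun γ ↦ (hE γ).some.toColimitPresentation.reindex (F ⋙ Pi.eval I γ),
    fun γ j ↦ (hE γ).some.prop_diag_obj _⟩

/-- This is the tool for both filteredness and density. Start from a stage with source `j` and raise
its target until the given factorizations are compatible with its approximate structure; then apply
`exists_hom_of_stage`. -/
lemma exists_extension (hlam : Cardinal.aleph0 ≤ lam) (hlamκ : lam < κ)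
    (hΓ : IsCardinalSmallTwoCategory Γ κ) (hH : TakesValuesInACC H lam κ)
    {E : ConicalPseudolimit H} {J : Type w} [PartialOrder J] [IsCardinalFiltered J κ]
    {p : ∀ γ, ColimitPresentation J ((proj H γ).obj E)}
    (hp : ∀ γ j, IsCardinalPresentable ((p γ).diag.obj j) κ)
    {A : Type*} (hA : HasCardinalLT A κ) (S : A → ConicalPseudolimit H)
    (hS : ∀ α, isComponentwisePresentable H κ (S α)) (π : ∀ α, S α ⟶ E) {j : J}
    (f : ∀ α γ, (proj H γ).obj (S α) ⟶ (p γ).diag.obj j)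
    (hf : ∀ α γ, f α γ ≫ (p γ).incl j = (proj H γ).map (π α)) :
    ∃ (X : ConicalPseudolimit H) (ρ : X ⟶ E)
      (n : ∀ γ, (p γ).diag.obj j ⟶ (proj H γ).obj X) (g : ∀ α, S α ⟶ X),
      isComponentwisePresentable H κ X ∧
      (∀ γ, n γ ≫ (proj H γ).map ρ = (p γ).incl j) ∧
      ∀ α γ, (proj H γ).map (g α) = f α γ ≫ n γ := by
  have := isFiltered_of_isCardinalFiltered J κ
  have := IsFiltered.isDirectedOrder J
  have := IsFiltered.nonempty (C := J)
  have (γ : Γ) := (hH.obj γ).hasColimitsOfChains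
  have (γ δ : Γ) (a : γ ⟶ δ) := (hH.map a).preservesChains
  have (γ δ : Γ) (a : γ ⟶ δ) : PreservesColimitsOfShape J (H.map a).toFunctor :=
    have := (hH.map a).preservesFiltered
    Functor.preservesColimitsOfShape_of_isCardinalAccessible _ κ J
  have (γ δ : Γ) (a : γ ⟶ δ) (j : J) :
      IsCardinalPresentable ((H.map a).toFunctor.obj ((p γ).diag.obj j)) κ :=
    (hH.map a).presentable _ (hp γ j)
  have hS' (α : A) (γ δ : Γ) (a : γ ⟶ δ) :
      IsCardinalPresentable ((H.map a).toFunctor.obj ((proj H γ).obj (S α))) κ :=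
    (hH.map a).presentable _ (hS α γ)
  obtain ⟨m, rfl⟩ := Stage.exists_src_eq p hΓ j
  have h : ∀ᶠ k in atTop, ∀ α γ δ (a : γ ⟶ δ) (h : m.tgt ≤ k) (h' : m.src ≤ k),
      ((H.map a).toFunctor.map (f α γ) ≫ m.fwd a) ≫ (p δ).tr h =
        ((S α).str a ≫ f α δ) ≫ (p δ).tr h' :=
    IsCardinalFiltered.eventually_forall hA fun α ↦
      IsCardinalFiltered.eventually_forall hΓ.objects fun γ ↦
        IsCardinalFiltered.eventually_forall hΓ.objects fun δ ↦
          IsCardinalFiltered.eventually_forall (hΓ.hom γ δ) fun a ↦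
            (p δ).eventually_eq κ _ _ (by
              rw [Category.assoc, Stage.fwd_incl, ← Functor.map_comp_assoc, hf,
                Category.assoc, hf, str_naturality])
  obtain ⟨k, hk, h⟩ := ((eventually_ge_atTop m.tgt).and h).exists
  have hmk := m.le.trans hk
  obtain ⟨X, ρ, n, hX, hn, hn'⟩ : ∃ (X : ConicalPseudolimit H) (ρ : X ⟶ E)
      (n : ∀ γ, (p γ).diag.obj k ⟶ (proj H γ).obj X),
      (∀ γ, IsCardinalPresentable ((proj H γ).obj X) κ) ∧
      (∀ γ, n γ ≫ (proj H γ).map ρ = (p γ).incl k) ∧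
      ∀ ⦃γ δ : Γ⦄ (a : γ ⟶ δ), (H.map a).toFunctor.map ((p γ).tr hmk ≫ n γ) ≫ X.str a =
        (m.fwd a ≫ (p δ).tr hk) ≫ n δ :=
    (m.raise hk).exists_hom_of_stage lam κ hlam hlamκ hΓ
  refine ⟨X, ρ, fun γ ↦ (p γ).tr hmk ≫ n γ, fun α ↦
    homMk (fun γ ↦ f α γ ≫ (p γ).tr hmk ≫ n γ) fun γ δ a ↦ ?_, hX, fun γ ↦ ?_,
    fun α γ ↦ rfl⟩
  · have h₁ := h α γ δ a hk hmk =≫ n δ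
    simp only [Category.assoc] at h₁ hn'
    rw [← h₁, Functor.map_comp, Category.assoc, hn']
  · rw [Category.assoc, hn, ColimitPresentation.tr_incl]

end ConicalPseudolimit

end

/-! ### Recognizing filtered colimits of presentable objects -/

namespace CategoryTheory.IsCardinalAccessibleCategory

/-- In a `κ`-accessible category, a cocone over a filtered diagram of `κ`-presentable objects
is colimit if morphisms from `κ`-presentable objects to its point factor essentially uniquely. -/
lemma nonempty_isColimit {C : Type u} [Category.{v} C] {κ : Cardinal.{w}} [Fact κ.IsRegular]
    [IsCardinalAccessibleCategory C κ] {I : Type u₁} [Category.{v₁} I] [IsFiltered I] {F : I ⥤ C}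
    (t : Cocone F) (hF : ∀ i, IsCardinalPresentable (F.obj i) κ)
    (h₁ : ∀ (Q : C) [IsCardinalPresentable Q κ] (f : Q ⟶ t.pt),
      ∃ (i : I) (g : Q ⟶ F.obj i), g ≫ t.ι.app i = f)
    (h₂ : ∀ (Q : C) [IsCardinalPresentable Q κ] (i : I) (f g : Q ⟶ F.obj i),
      f ≫ t.ι.app i = g ≫ t.ι.app i → ∃ (j : I) (k : i ⟶ j), f ≫ F.map k = g ≫ F.map k) :
    Nonempty (IsColimit t) := by
  -- The conditions `h₁` and `h₂` say that this comparison with the canonical diagram of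
  -- presentables over the point is final, and the canonical cocone is colimit by density.
  let G : I ⥤ CostructuredArrow (isCardinalPresentable C κ).ι t.pt :=
    { obj := fun i ↦ CostructuredArrow.mk
        (Y := (⟨F.obj i, hF i⟩ : (isCardinalPresentable C κ).FullSubcategory)) (by exact t.ι.app i)
      map := fun k ↦ CostructuredArrow.homMk (ObjectProperty.homMk (F.map k)) (by exact t.w k)
      map_id := fun i ↦ by
        ext
        exact F.map_id i
      map_comp := fun k l ↦ by
        ext
        exact F.map_comp k l }
  have : G.Final := Functor.final_of_exists_of_isFiltered G
    (fun d ↦ by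
      have := d.left.property
      obtain ⟨i, g, hg⟩ := h₁ d.left.obj d.hom
      exact ⟨i, ⟨CostructuredArrow.homMk (ObjectProperty.homMk g) (by exact hg)⟩⟩)
    (fun {d i} f g ↦ by
      have := d.left.property
      obtain ⟨j, k, h⟩ := h₂ d.left.obj i f.left.hom g.left.hom
        ((CostructuredArrow.w f).trans (CostructuredArrow.w g).symm)
      refine ⟨j, k, ?_⟩
      ext
      exact h)
  exact ⟨((Functor.Final.isColimitWhiskerEquiv G _).symm
    ((isCardinalPresentable C κ).ι.denseAt t.pt)).ofIsoColimit
      (Cocone.ext (Iso.refl _) fun i ↦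
        (Category.comp_id _).trans (Category.id_comp _))⟩

end CategoryTheory.IsCardinalAccessibleCategory

/-! ### Accessibility of the pseudolimit -/

section

variable {Γ : Type w} [Bicategory.{w, w} Γ] [Bicategory.Strict Γ]

namespace ConicalPseudolimit

open Filter

variable {H : StrictPseudofunctor Γ Cat.{w, u}} {lam κ : Cardinal.{w}} [Fact κ.IsRegular]

/-- Up to isomorphism, such an object is determined by components chosen from small sets of
representatives and by the transported structure morphisms. -/
lemma essentiallySmall_isComponentwisePresentable
    (hH : ∀ γ, IsCardinalAccessibleCategory (H.obj γ) κ) :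
    ObjectProperty.EssentiallySmall.{w} (isComponentwisePresentable H κ) := by
  have h (γ : Γ) : ∃ (Q : ObjectProperty (H.obj γ)) (_ : ObjectProperty.Small.{w} Q),
      isCardinalPresentable (H.obj γ) κ ≤ Q.isoClosure :=
    ObjectProperty.EssentiallySmall.exists_small_le' _
  choose Q hQ hQ' using h
  let T := Σ (r : ∀ γ, Subtype (Q γ)), ∀ (x : Σ (γ δ : Γ), (γ ⟶ δ)),
    ((H.map x.2.2).toFunctor.obj (r x.1).1 ⟶ (r x.2.1).1)
  let R (t : T) (S : ConicalPseudolimit H) : Prop :=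
    ∃ (e : ∀ γ, (proj H γ).obj S ≅ (t.1 γ).1), ∀ ⦃γ δ : Γ⦄ (a : γ ⟶ δ),
      S.str a ≫ (e δ).hom = (H.map a).toFunctor.map (e γ).hom ≫ t.2 ⟨γ, δ, a⟩
  have hR {t : T} {S S' : ConicalPseudolimit H} (h : R t S) (h' : R t S') : Nonempty (S ≅ S') := by
    obtain ⟨e, he⟩ := h
    obtain ⟨e', he'⟩ := h'
    refine ⟨isoMk (fun γ ↦ e γ ≪≫ (e' γ).symm) fun γ δ a ↦ ?_⟩
    rw [← cancel_mono (e' δ).hom]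
    simp only [Iso.trans_hom, Iso.symm_hom, Category.assoc, Iso.inv_hom_id, Category.comp_id,
      he, he', Functor.map_comp]
    rw [← Functor.map_comp_assoc _ (e' γ).inv, Iso.inv_hom_id, CategoryTheory.Functor.map_id,
      Category.id_comp]
  -- No coherence is required in `T`, so only the realized data are kept.
  let X (t : { t : T // ∃ S, R t S }) : ConicalPseudolimit H := t.2.choose
  refine ⟨ObjectProperty.ofObj X, inferInstance, fun S hS ↦ ?_⟩
  have h (γ : Γ) : ∃ r : Subtype (Q γ), Nonempty ((proj H γ).obj S ≅ r.1) := by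
    obtain ⟨r, hr, e⟩ := hQ' γ _ (hS γ)
    exact ⟨⟨r, hr⟩, e⟩
  choose r e using h
  let t : T := ⟨r, fun x ↦ (H.map x.2.2).toFunctor.map (e x.1).some.inv ≫ S.str x.2.2 ≫
    (e x.2.1).some.hom⟩
  have ht : R t S := ⟨fun γ ↦ (e γ).some, fun γ δ a ↦ by
    rw [← Functor.map_comp_assoc, Iso.hom_inv_id, CategoryTheory.Functor.map_id,
      Category.id_comp]⟩
  have ht' : ∃ S, R t S := ⟨S, ht⟩
  exact ⟨X ⟨t, ht'⟩, ObjectProperty.ofObj_apply X _, hR ht ht'.choose_spec⟩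

/-- The canonical cocone exhibiting an object of the conical pseudolimit as a colimit of objects
with `κ`-presentable components. -/
def canonicalCocone (κ : Cardinal.{w}) [Fact κ.IsRegular] (E : ConicalPseudolimit H) :
    Cocone (CostructuredArrow.proj (isComponentwisePresentable H κ).ι E ⋙
      (isComponentwisePresentable H κ).ι) where
  pt := E
  ι :=
    { app := fun s ↦ s.hom
      naturality := fun _ _ φ ↦ (CostructuredArrow.w φ).trans (Category.comp_id _).symm }

section

variable (hlam : Cardinal.aleph0 ≤ lam) (hlamκ : lam < κ)
  (hΓ : IsCardinalSmallTwoCategory Γ κ) (hH : TakesValuesInACC H lam κ) (E : ConicalPseudolimit H)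

include hlam hlamκ hΓ hH

/-- Given a small diagram over `E`, factor all components of its objects through one index and move
on until they are compatible with the arrows of the diagram. The extension through that index is
then the point of a cocone. -/
lemma isCardinalFiltered_costructuredArrow :
    IsCardinalFiltered (CostructuredArrow (isComponentwisePresentable H κ).ι E) κ := by
  obtain ⟨J, _, _, p, hp⟩ := exists_presentation E fun γ ↦ (hH.obj γ).accessible
  have := isFiltered_of_isCardinalFiltered J κ
  have := IsFiltered.isDirectedOrder J
  have := IsFiltered.nonempty (C := J)
  refine ⟨fun {A _} F hA ↦ ?_⟩
  have hA' : HasCardinalLT A κ := hasCardinalLT_of_hasCardinalLT_arrow hA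
  let S (α : A) : ConicalPseudolimit H := (F.obj α).left.obj
  have hS (α : A) (γ : Γ) : IsCardinalPresentable ((proj H γ).obj (S α)) κ :=
    (F.obj α).left.property γ
  let π (α : A) : S α ⟶ E := (F.obj α).hom
  let s {α β : A} (φ : α ⟶ β) : S α ⟶ S β := (F.map φ).left.hom
  have hs {α β : A} (φ : α ⟶ β) : s φ ≫ π β = π α := CostructuredArrow.w (F.map φ)
  obtain ⟨j, hj⟩ := (IsCardinalFiltered.eventually_forall hA' fun α ↦
    IsCardinalFiltered.eventually_forall hΓ.objects fun γ ↦
      (p γ).eventually_exists_hom κ ((proj H γ).map (π α))).exists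
  choose f hf using hj
  have h : ∀ᶠ k in atTop, ∀ (φ : Arrow A) (γ : Γ) (h h' : j ≤ k),
      ((proj H γ).map (s φ.hom) ≫ f φ.right γ) ≫ (p γ).tr h = f φ.left γ ≫ (p γ).tr h' :=
    IsCardinalFiltered.eventually_forall hA fun φ ↦
      IsCardinalFiltered.eventually_forall hΓ.objects fun γ ↦
        (p γ).eventually_eq κ _ _ (by
          rw [Category.assoc, hf, hf, ← Functor.map_comp, hs])
  obtain ⟨k, hk, h⟩ := ((eventually_ge_atTop j).and h).exists
  obtain ⟨X, ρ, n, g, hX, hn, hg⟩ := exists_extension hlam hlamκ hΓ hH hp hA' S hS π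
    (fun α γ ↦ f α γ ≫ (p γ).tr hk) (fun α γ ↦ by
      rw [Category.assoc, ColimitPresentation.tr_incl, hf])
  have hgρ (α : A) : g α ≫ ρ = π α := hom_ext fun γ ↦ by
    rw [Functor.map_comp, hg, Category.assoc, hn, Category.assoc, ColimitPresentation.tr_incl, hf]
  have hsg {α β : A} (φ : α ⟶ β) : s φ ≫ g β = g α := hom_ext fun γ ↦ by
    rw [Functor.map_comp, hg, hg, ← Category.assoc, ← Category.assoc]
    exact h (Arrow.mk φ) γ hk hk =≫ n γ
  exact ⟨{
    pt := CostructuredArrow.mk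
      (Y := (⟨X, hX⟩ : (isComponentwisePresentable H κ).FullSubcategory)) (by exact ρ)
    ι :=
      { app := fun α ↦ CostructuredArrow.homMk (ObjectProperty.homMk (g α)) (by exact hgρ α)
        naturality := fun α β φ ↦ by
          ext : 2
          exact (hsg φ).trans (Category.comp_id _).symm } }⟩

/-- Morphisms from presentables to `E_γ` lift by extending the empty family. Two lifts that agree in
`E_γ` are identified by extending the one-object family through an index at which they already
agree. -/
lemma nonempty_isColimit_canonicalCocone (γ : Γ) :
    Nonempty (IsColimit ((proj H γ).mapCocone (canonicalCocone κ E))) := by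
  have := isCardinalFiltered_costructuredArrow hlam hlamκ hΓ hH E
  have := isFiltered_of_isCardinalFiltered
    (CostructuredArrow (isComponentwisePresentable H κ).ι E) κ
  have := (hH.obj γ).accessible
  obtain ⟨J, _, _, p, hp⟩ := exists_presentation E fun γ ↦ (hH.obj γ).accessible
  have := isFiltered_of_isCardinalFiltered J κ
  have := IsFiltered.isDirectedOrder J
  have := IsFiltered.nonempty (C := J)
  have hfin (A : Type) [Finite A] : HasCardinalLT A κ :=
    hasCardinalLT_of_finite _ _ (hlam.trans hlamκ.le)
  refine IsCardinalAccessibleCategory.nonempty_isColimit (κ := κ) _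
    (fun s ↦ s.left.property γ) (fun Q _ f ↦ ?_) (fun Q _ s f f' hff' ↦ ?_)
  · obtain ⟨j, g, hg⟩ := ((p γ).eventually_exists_hom κ (by exact f)).exists
    obtain ⟨X, ρ, n, -, hX, hn, -⟩ := exists_extension hlam hlamκ hΓ hH hp (hfin Empty)
      Empty.elim (fun α ↦ α.elim) (fun α ↦ α.elim) (j := j) (fun α ↦ α.elim) (fun α ↦ α.elim)
    refine ⟨CostructuredArrow.mk
      (Y := (⟨X, hX⟩ : (isComponentwisePresentable H κ).FullSubcategory)) (by exact ρ),
      g ≫ n γ, ?_⟩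
    have : (g ≫ n γ) ≫ (proj H γ).map ρ = f := by rw [Category.assoc, hn, hg]
    exact this
  · let S : ConicalPseudolimit H := s.left.obj
    have hS (γ : Γ) : IsCardinalPresentable ((proj H γ).obj S) κ := s.left.property γ
    let π : S ⟶ E := s.hom
    change Q ⟶ (proj H γ).obj S at f f'
    replace hff' : f ≫ (proj H γ).map π = f' ≫ (proj H γ).map π := hff'
    obtain ⟨j, hj⟩ := (IsCardinalFiltered.eventually_forall hΓ.objects fun γ ↦
      (p γ).eventually_exists_hom κ ((proj H γ).map π)).exists
    choose g hg using hj
    obtain ⟨k, hk, h⟩ := ((eventually_ge_atTop j).and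
      ((p γ).eventually_eq κ (f ≫ g γ) (f' ≫ g γ) (by
        rw [Category.assoc, Category.assoc, hg, hff']))).exists
    obtain ⟨X, ρ, n, l, hX, hn, hl⟩ := exists_extension hlam hlamκ hΓ hH hp (hfin Unit)
      (fun _ ↦ S) (fun _ ↦ hS) (fun _ ↦ π) (fun _ γ ↦ g γ ≫ (p γ).tr hk) (fun _ γ ↦ by
        rw [Category.assoc, ColimitPresentation.tr_incl, hg])
    have hlρ : l ⟨⟩ ≫ ρ = π := hom_ext fun γ ↦ by
      rw [Functor.map_comp, hl, Category.assoc, hn, Category.assoc,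
        ColimitPresentation.tr_incl, hg]
    refine ⟨CostructuredArrow.mk
      (Y := (⟨X, hX⟩ : (isComponentwisePresentable H κ).FullSubcategory)) (by exact ρ),
      CostructuredArrow.homMk (ObjectProperty.homMk (l ⟨⟩)) (by exact hlρ), ?_⟩
    have : f ≫ (proj H γ).map (l ⟨⟩) = f' ≫ (proj H γ).map (l ⟨⟩) := by
      have h' := h hk hk =≫ n γ
      simp only [Category.assoc] at h'
      rw [hl, Category.assoc, h']
    exact this

lemma isCardinalPresentable_of_isComponentwisePresentable (S : ConicalPseudolimit H)
    (hS : isComponentwisePresentable H κ S) : IsCardinalPresentable S κ :=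
  isCardinalPresentable_of_proj hΓ (fun γ ↦ (hH.obj γ).accessible.toHasCardinalFilteredColimits)
    (fun _ _ a ↦ (hH.map a).preservesFiltered) (fun _ _ a ↦ (hH.map a).presentable) S hS

lemma isCardinalFilteredGenerator_isComponentwisePresentable :
    (isComponentwisePresentable H κ).IsCardinalFilteredGenerator κ where
  le_isCardinalPresentable :=
    isCardinalPresentable_of_isComponentwisePresentable hlam hlamκ hΓ hH
  exists_colimitsOfShape E := by
    have := essentiallySmall_isComponentwisePresentable fun γ ↦ (hH.obj γ).accessible
    -- This category is only essentially small; the colimit is formed over it directly and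
    -- transferred to a small model at the end.
    let I := CostructuredArrow (isComponentwisePresentable H κ).ι E
    have : IsCardinalFiltered I κ := isCardinalFiltered_costructuredArrow hlam hlamκ hΓ hH E
    have (γ δ : Γ) (a : γ ⟶ δ) : PreservesColimitsOfShape I (H.map a).toFunctor :=
      have := (hH.map a).preservesFiltered
      Functor.preservesColimitsOfShape_of_isCardinalAccessible_of_essentiallySmall _ κ I
    have hc : IsColimit (canonicalCocone κ E) := isColimitOfProj _ fun γ ↦
      (nonempty_isColimit_canonicalCocone hlam hlamκ hΓ hH E γ).some
    refine ⟨SmallModel.{w} I, inferInstance,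
      IsCardinalFiltered.of_equivalence κ (equivSmallModel.{w} I), ?_⟩
    rw [← ObjectProperty.colimitsOfShape_congr _ (equivSmallModel.{w} I)]
    exact ⟨{ diag := _, ι := _, isColimit := hc, prop_diag_obj := fun s ↦ s.left.property }⟩

/-- For the forward direction, presentable objects are retracts of members of the generator, and
`κ`-presentability in `H γ` is stable under retracts. -/
lemma isCardinalPresentable_iff_proj (S : ConicalPseudolimit H) :
    IsCardinalPresentable S κ ↔ ∀ γ, IsCardinalPresentable ((proj H γ).obj S) κ := by
  refine ⟨fun hS γ ↦ ?_, isCardinalPresentable_of_isComponentwisePresentable hlam hlamκ hΓ hH S⟩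
  have hS' : isCardinalPresentable (ConicalPseudolimit H) κ S := hS
  rw [(isCardinalFilteredGenerator_isComponentwisePresentable hlam hlamκ hΓ
    hH).isPresentable_eq_retractClosure] at hS'
  obtain ⟨S', hS', ⟨r⟩⟩ := hS'
  have h : (isCardinalPresentable (H.obj γ) κ).retractClosure ((proj H γ).obj S) :=
    ⟨_, hS' γ, ⟨r.map (proj H γ)⟩⟩
  rwa [ObjectProperty.retractClosure_eq_self] at h

lemma isACCObject : IsACCObject (ConicalPseudolimit H) lam κ := by
  have := essentiallySmall_isComponentwisePresentable fun γ ↦ (hH.obj γ).accessible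
  have := (isCardinalFilteredGenerator_isComponentwisePresentable hlam hlamκ hΓ
    hH).hasCardinalFilteredGenerator
  have : HasCardinalFilteredColimits (ConicalPseudolimit H) κ := ⟨fun J _ _ ↦
    have (γ : Γ) := (hH.obj γ).accessible
    have (γ : Γ) : HasColimitsOfShape J (H.obj γ) :=
      HasCardinalFilteredColimits.hasColimitsOfShape _ κ J
    have (γ δ : Γ) (a : γ ⟶ δ) : PreservesColimitsOfShape J (H.map a).toFunctor :=
      have := (hH.map a).preservesFiltered
      Functor.preservesColimitsOfShape_of_isCardinalAccessible _ κ J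
    hasColimitsOfShape H J⟩
  have (γ : Γ) := (hH.obj γ).hasColimitsOfChains
  have (γ δ : Γ) (a : γ ⟶ δ) := (hH.map a).preservesChains
  exact ⟨{}, hasColimitsOfShape H _⟩

lemma isACCFunctor_proj (γ : Γ) : IsACCFunctor (proj H γ) lam κ where
  preservesFiltered := ⟨fun J _ _ ↦
    have (γ : Γ) := (hH.obj γ).accessible
    have (γ : Γ) : HasColimitsOfShape J (H.obj γ) :=
      HasCardinalFilteredColimits.hasColimitsOfShape _ κ J
    have (γ δ : Γ) (a : γ ⟶ δ) : PreservesColimitsOfShape J (H.map a).toFunctor :=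
      have := (hH.map a).preservesFiltered
      Functor.preservesColimitsOfShape_of_isCardinalAccessible _ κ J
    preservesColimitsOfShape_proj H J γ⟩
  preservesChains :=
    have (γ : Γ) := (hH.obj γ).hasColimitsOfChains
    have (γ δ : Γ) (a : γ ⟶ δ) := (hH.map a).preservesChains
    preservesColimitsOfShape_proj H _ γ
  presentable S hS := (isCardinalPresentable_iff_proj hlam hlamκ hΓ hH S).1 hS γ

end

end ConicalPseudolimit

end

end

theorem theorem7p3 {Γ : Type w} [Bicategory.{w, w} Γ] [Bicategory.Strict Γ]
    (lam κ : Cardinal.{w}) [Fact κ.IsRegular]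
    (hlam : Cardinal.aleph0 ≤ lam) (hlamκ : lam < κ)
    (hΓ : IsCardinalSmallTwoCategory Γ κ)
    (H : StrictPseudofunctor Γ Cat.{w, u}) (hH : TakesValuesInACC H lam κ) :
    IsACCObject (ConicalPseudolimit H) lam κ ∧
    (∀ γ : Γ, IsACCFunctor (ConicalPseudolimit.proj H γ) lam κ) ∧
    (∀ S : ConicalPseudolimit H,
      IsCardinalPresentable S κ ↔
        ∀ γ : Γ, IsCardinalPresentable ((ConicalPseudolimit.proj H γ).obj S) κ) :=
  ⟨ConicalPseudolimit.isACCObject hlam hlamκ hΓ hH,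
    ConicalPseudolimit.isACCFunctor_proj hlam hlamκ hΓ hH,
    ConicalPseudolimit.isCardinalPresentable_iff_proj hlam hlamκ hΓ hH⟩
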